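/- Let $(C_\theta)_{\theta\in\Theta}$ be symmetric, positive-definite kernels on $[0,1]^d$ (every Gram matrix at distinct points is positive definite) with $\int_{[0,1]^d}\sqrt{C_\theta(t,t)}\,dt<\infty$. Let $f$ be a jointly measurable random function on $[0,1]^d$ which, under the probability measure $\mathbb P_{m,s^2,\theta}$ ($m\in\mathbb R$, $s^2>0$, $\theta\in\Theta$), is a Gaussian process with constant mean $m$ and covariance function $s^2C_\theta$, and let $\mu=\int_{[0,1]^d}f(t)\,dt$. Let $x_1,\dots,x_n\in[0,1]^d$ be distinct, $\mathbf f=(f(x_i))_{i=1}^n$, and let the observed data $\mathbf y\in\mathbb R^n$ be non-constant (so $n\ge2$). Put $\mathsf C=\mathsf C_\theta=(C_\theta(x_i,x_j))_{i,j}$, $\mathbf c=(\int C_\theta(t,x_i)\,dt)_i$, $c_0=\iint C_\theta(x,t)\,dx\,dt$, and let $\mathbf 1$ be the vector of ones. Densities of Gaussian vectors are the continuous ones, and conditional distributions given $\mathbf f=\mathbf y$ are defined through them. Let $z_{0.995}$ and $t_{n-1,0.995}$ be the 99.5 percentiles of the standard normal distribution and of Student's $t$-distribution with $n-1$ degrees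 of freedom; $z_{0.995}=2.58$ to two decimals, that is, $|z_{0.995}-2.58|<0.005$. (1) Empirical Bayes. Let $l(m,s^2,\theta)$ be the log-likelihood, i.e. the logarithm of the density of $\mathbf f$ at $\mathbf y$ under $\mathbb P_{m,s^2,\theta}$. For all $\theta$ and $s^2$, the unique maximizer of $l$ in $m$ is $$m_{\rm EB}=\frac{\mathbf 1^T\mathsf C^{-1}\mathbf y}{\mathbf 1^T\mathsf C^{-1}\mathbf 1};$$ for all $\theta$ the unique maximizer of $l(m_{\rm EB},s^2,\theta)$ in $s^2>0$ is $$s^2_{\rm EB}=\frac1n\,\mathbf y^T\Big[\mathsf C^{-1}-\frac{\mathsf C^{-1}\mathbf 1\mathbf 1^T\mathsf C^{-1}}{\mathbf 1^T\mathsf C^{-1}\mathbf 1}\Big]\mathbf y>0;$$ and the maximizers of $l(m_{\rm EB},s^2_{\rm EB},\theta)$ in $\theta$ are exactly the minimizers of $$\log\Big(\mathbf y^T\Big[\mathsf C_\theta^{-1}-\frac{\mathsf C_\theta^{-1}\mathbf 1\mathbf 1^T\mathsf C_\theta^{-1}}{\mathbf 1^T\mathsf C_\theta^{-1}\mathbf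 1}\Big]\mathbf y\Big)+\frac1n\log\det\mathsf C_\theta .$$ (2) Generalized cross-validation. Let $(a_{ij})=\mathsf C^{-1}$ and $\boldsymbol\zeta=\mathsf C^{-1}(\mathbf y-m\mathbf 1)$. Under $\mathbb P_{m,s^2,\theta}$ the conditional distribution of $f(x_i)$ given $f(x_j)=y_j$ for all $j\ne i$ has mean $\widetilde y_i$ with $y_i-\widetilde y_i=\zeta_i/a_{ii}$ and variance $s^2/a_{ii}$. Let $$\mathrm{GCV}(m,\theta)=\frac{\sum_i\zeta_i^2}{\big(\frac1n\sum_ia_{ii}\big)^2},$$ which is $\sum_i(y_i-\widetilde y_i)^2=\sum_i(\zeta_i/a_{ii})^2$ with each $a_{ii}$ replaced by the average. For all $\theta$ its unique minimizer in $m$ is $$m_{\rm GCV}=\frac{\mathbf 1^T\mathsf C^{-2}\mathbf y}{\mathbf 1^T\mathsf C^{-2}\mathbf 1},$$ and the minimizers of $\mathrm{GCV}(m_{\rm GCV},\theta)$ in $\theta$ are exactly the minimizers of $$\log\Big(\mathbf y^T\Big[\mathsf C_\theta^{-2}-\frac{\mathsf C_\theta^{-2}\mathbf 1\mathbf 1^T\mathsf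 C_\theta^{-2}}{\mathbf 1^T\mathsf C_\theta^{-2}\mathbf 1}\Big]\mathbf y\Big)-2\log\operatorname{trace}(\mathsf C_\theta^{-1}).$$ The cross-validation estimate of $s^2$, namely $\frac1n\sum_i\zeta_i^2\big/\frac1n\sum_ia_{ii}$ at $m=m_{\rm GCV}$, equals $$s^2_{\rm GCV}=\mathbf y^T\Big[\mathsf C^{-2}-\frac{\mathsf C^{-2}\mathbf 1\mathbf 1^T\mathsf C^{-2}}{\mathbf 1^T\mathsf C^{-2}\mathbf 1}\Big]\mathbf y\,\big[\operatorname{trace}(\mathsf C^{-1})\big]^{-1}>0 .$$ (3) Cubatures and credible intervals. For every $\theta$ (in particular for $\theta$ minimizing the objective function in (1) or (2), as appropriate) with $c_0-\mathbf c^T\mathsf C^{-1}\mathbf c>0$: (a) For $\mathsf x\in\{\mathrm{EB},\mathrm{GCV}\}$, the mean of the conditional distribution of $\mu$ given $\mathbf f=\mathbf y$ under $\mathbb P_{m_{\mathsf x},s^2_{\mathsf x},\theta}$ is $\widehat\mu_{\mathsf x}$, where $$\widehat\mu_{\rm EB}=\Big(\frac{(1-\mathbf 1^T\mathsf C^{-1}\mathbf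 c)\mathbf 1}{\mathbf 1^T\mathsf C^{-1}\mathbf 1}+\mathbf c\Big)^T\mathsf C^{-1}\mathbf y,\qquad \widehat\mu_{\rm GCV}=\Big(\frac{(1-\mathbf 1^T\mathsf C^{-1}\mathbf c)\mathsf C^{-1}\mathbf 1}{\mathbf 1^T\mathsf C^{-2}\mathbf 1}+\mathbf c\Big)^T\mathsf C^{-1}\mathbf y,$$ and this distribution gives $\{|\mu-\widehat\mu_{\mathsf x}|\le\mathrm{err}_{\mathsf x}\}$ probability exactly $99\%$, where $\mathrm{err}_{\mathsf x}=z_{0.995}\,s_{\mathsf x}\sqrt{c_0-\mathbf c^T\mathsf C^{-1}\mathbf c}$. With $z_{0.995}$ replaced by its rounded value $2.58$ the probability lies strictly between $99\%$ and $99.05\%$. (b) Full Bayes. Give $(m,s^2)=(\xi,\lambda)\in\mathbb R\times(0,\infty)$ the improper prior density proportional to $1/\lambda$. Then the posterior distribution of $\mu$ given $\mathbf f=\mathbf y$ is a probability distribution under which $(\mu-\widehat\mu_{\rm full})/\widehat\sigma_{\rm full}$ has Student's $t$-distribution with $n-1$ degrees of freedom, where $\widehat\mu_{\rm full}=\widehat\mu_{\rm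 EB}$ (the posterior mean if $n\ge3$) and $$\widehat\sigma^2_{\rm full}=\frac1{n-1}\,\mathbf y^T\Big[\mathsf C^{-1}-\frac{\mathsf C^{-1}\mathbf 1\mathbf 1^T\mathsf C^{-1}}{\mathbf 1^T\mathsf C^{-1}\mathbf 1}\Big]\mathbf y\,\Big[\frac{(1-\mathbf c^T\mathsf C^{-1}\mathbf 1)^2}{\mathbf 1^T\mathsf C^{-1}\mathbf 1}+(c_0-\mathbf c^T\mathsf C^{-1}\mathbf c)\Big]>0 .$$ The posterior probability of $\{|\mu-\widehat\mu_{\rm full}|\le\mathrm{err}_{\rm full}\}$ is $99\%$, where $\mathrm{err}_{\rm full}=t_{n-1,0.995}\,\widehat\sigma_{\rm full}$, and $\mathrm{err}_{\rm full}>\mathrm{err}_{\rm EB}$. -/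

import Mathlib

open MeasureTheory ProbabilityTheory Matrix
open scoped ENNReal

noncomputable section

namespace BayesCub

/-- The unit cube `[0,1]^d`; its `volume` is Lebesgue measure (the product of the Lebesgue
measures on the factors). -/
abbrev Cube (d : ℕ) : Type := Fin d → unitInterval

/-- Symmetric positive-definite kernels: every Gram matrix at finitely many distinct points
is symmetric and positive definite. -/
def IsPosDefKernel {X : Type*} (K : X → X → ℝ) : Prop :=
  ∀ (k : ℕ) (x : Fin k → X), Function.Injective x → (Matrix.of fun i j => K (x i) (x j)).PosDef

/-- Under the measure `P`, the random function `f` is a Gaussian process with constant mean `m`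
and covariance function `K`. -/
structure IsGP {X Ω : Type*} [MeasurableSpace Ω] (P : Measure Ω) (f : X → Ω → ℝ)
    (m : ℝ) (K : X → X → ℝ) : Prop where
  gaussian : IsGaussianProcess f P
  mean : ∀ t, ∫ ω, f t ω ∂P = m
  cov : ∀ t u, cov[f t, f u; P] = K t u

/-! ### Densities, posteriors, quantiles -/

/-- `p` is a continuous Lebesgue density of `ν`. -/
def IsContDensity {E : Type*} [TopologicalSpace E] [MeasureSpace E] (ν : Measure E)
    (p : E → ℝ) : Prop :=
  Continuous p ∧ (∀ e, 0 ≤ p e) ∧ ν = volume.withDensity fun e => ENNReal.ofReal (p e)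

open Classical in
/-- The continuous Lebesgue density of `ν` (unique on the spaces `ℝⁿ` and `ℝⁿ × ℝ`), and `0` if
there is none. -/
def density {E : Type*} [TopologicalSpace E] [MeasureSpace E] (ν : Measure E) : E → ℝ :=
  if h : ∃ p, IsContDensity ν p then h.choose else 0

/-- The measure on `ℝ` with density proportional to `p`, normalized to total mass one. -/
def normalized (p : ℝ → ℝ≥0∞) : Measure ℝ :=
  volume.withDensity fun z => p z / ∫⁻ w, p w

/-- The `p`-quantile of a probability measure on `ℝ`. -/
def quantile (ν : Measure ℝ) (p : ℝ) : ℝ := sInf {t : ℝ | p ≤ cdf ν t}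

/-- Student's `t`-distribution with `ν` degrees of freedom. -/
def studentT (ν : ℝ) : Measure ℝ :=
  volume.withDensity fun t => ENNReal.ofReal
    (Real.Gamma ((ν + 1) / 2) / (Real.sqrt (ν * Real.pi) * Real.Gamma (ν / 2)) *
      (1 + t ^ 2 / ν) ^ (-((ν + 1) / 2)))

/-! ### The statistical model: integrand data, integral, likelihood, posteriors -/

section Model

variable {d n : ℕ} {Ω Θ : Type*} [MeasurableSpace Ω]

/-- The random vector `𝐟 = (f(x₁), …, f(xₙ))` of integrand values. -/
def dataVec (f : Cube d → Ω → ℝ) (x : Fin n → Cube d) (ω : Ω) : Fin n → ℝ := fun i => f (x i) ω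

/-- The integral `μ = ∫_{[0,1]^d} f(t) dt`. -/
def integralOf (f : Cube d → Ω → ℝ) (ω : Ω) : ℝ := ∫ t, f t ω

/-- `ρ_𝐟(y)`: the density at `y` of the random vector `𝐟` under `P`. -/
def likelihood (P : Measure Ω) (f : Cube d → Ω → ℝ) (x : Fin n → Cube d) (y : Fin n → ℝ) : ℝ :=
  density (P.map (dataVec f x)) y

/-- The log-likelihood of the law `P` of the integrand given the data `𝐟 = y`. -/
def logLik (P : Measure Ω) (f : Cube d → Ω → ℝ) (x : Fin n → Cube d) (y : Fin n → ℝ) : ℝ :=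
  Real.log (likelihood P f x y)

/-- `ρ_{𝐟,μ}(y,z)`: the joint density at `(y,z)` of the data and the integral under `P`. -/
def jointDensity (P : Measure Ω) (f : Cube d → Ω → ℝ) (x : Fin n → Cube d)
    (y : Fin n → ℝ) (z : ℝ) : ℝ :=
  density (P.map fun ω => (dataVec f x ω, integralOf f ω)) (y, z)

/-- The conditional distribution of the integral `μ` given `𝐟 = y` when the integrand has
law `P`. -/
def posterior (P : Measure Ω) (f : Cube d → Ω → ℝ) (x : Fin n → Cube d)
    (y : Fin n → ℝ) : Measure ℝ :=
  normalized fun z => ENNReal.ofReal (jointDensity P f x y z)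

/-- The posterior distribution of the integral `μ` given `𝐟 = y` when the parameters
`(m, s²) = (ξ, lam)` of the laws `P ξ lam`, `ξ ∈ ℝ`, `lam ∈ (0,∞)`, carry the (possibly improper)
prior density `π ξ lam`. -/
def posteriorOfPrior (π : ℝ → ℝ → ℝ) (P : ℝ → ℝ → Measure Ω) (f : Cube d → Ω → ℝ)
    (x : Fin n → Cube d) (y : Fin n → ℝ) : Measure ℝ :=
  normalized fun z => ∫⁻ lam in Set.Ioi (0 : ℝ), ∫⁻ ξ : ℝ,
    ENNReal.ofReal (jointDensity (P ξ lam) f x y z) * ENNReal.ofReal (π ξ lam)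

/-- The conditional distribution of `f(xᵢ)` given `f(xⱼ) = yⱼ` for all `j ≠ i`, when the integrand
has law `P`. -/
def leaveOneOut (P : Measure Ω) (f : Cube d → Ω → ℝ) (x : Fin n → Cube d)
    (y : Fin n → ℝ) (i : Fin n) : Measure ℝ :=
  normalized fun z => ENNReal.ofReal (likelihood P f x (Function.update y i z))

end Model

/-! ### Gram matrix and kernel integrals -/

section Kernel

variable {d n : ℕ}

/-- The Gram matrix `𝖢`. -/
def gram (K : Cube d → Cube d → ℝ) (x : Fin n → Cube d) : Matrix (Fin n) (Fin n) ℝ :=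
  Matrix.of fun i j => K (x i) (x j)

/-- The vector `𝐜`. -/
def cVec (K : Cube d → Cube d → ℝ) (x : Fin n → Cube d) : Fin n → ℝ := fun i => ∫ t, K t (x i)

/-- The number `c₀`. -/
def c0 (K : Cube d → Cube d → ℝ) : ℝ := ∫ p : Cube d × Cube d, K p.1 p.2

end Kernel

/-! ### Generalized cross-validation -/

section GCV

variable {n : ℕ}

/-- `ζ = 𝖢⁻¹ (y - m 𝟏)`. -/
def zeta (G : Matrix (Fin n) (Fin n) ℝ) (y : Fin n → ℝ) (m : ℝ) : Fin n → ℝ :=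
  G⁻¹ *ᵥ (y - m • 1)

/-- The criterion GCV: in `∑ᵢ (ζᵢ / aᵢᵢ)²`, where `(aᵢⱼ) = 𝖢⁻¹`, every `aᵢᵢ` is replaced by the
average of the diagonal of `𝖢⁻¹`. -/
def gcv (G : Matrix (Fin n) (Fin n) ℝ) (y : Fin n → ℝ) (m : ℝ) : ℝ :=
  (∑ i, zeta G y m i ^ 2) / (1 / (n : ℝ) * ∑ i, G⁻¹ i i) ^ 2

/-- The cross-validation estimate of `s²` for given `m`: in `(1/n) ∑ᵢ ζᵢ² / aᵢᵢ`, every `aᵢᵢ` is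
replaced by the average of the diagonal of `𝖢⁻¹`. -/
def gcvScale (G : Matrix (Fin n) (Fin n) ℝ) (y : Fin n → ℝ) (m : ℝ) : ℝ :=
  (1 / (n : ℝ) * ∑ i, zeta G y m i ^ 2) / (1 / (n : ℝ) * ∑ i, G⁻¹ i i)

end GCV

/-! ### The explicit formulas -/

section Formulas

variable {n : ℕ} (G : Matrix (Fin n) (Fin n) ℝ) (y c : Fin n → ℝ) (c₀ : ℝ)

/-- `yᵀ [A - A𝟏𝟏ᵀA / 𝟏ᵀA𝟏] y`. -/
def projQuad (A : Matrix (Fin n) (Fin n) ℝ) (y : Fin n → ℝ) : ℝ :=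
  y ⬝ᵥ ((A - (1 / (1 ⬝ᵥ A *ᵥ 1)) • (A * vecMulVec 1 1 * A)) *ᵥ y)

/-- `c₀ - 𝐜ᵀ𝖢⁻¹𝐜`. -/
def condVar : ℝ := c₀ - c ⬝ᵥ G⁻¹ *ᵥ c

/-- `m_EB`. -/
def mEB : ℝ := (1 ⬝ᵥ G⁻¹ *ᵥ y) / (1 ⬝ᵥ G⁻¹ *ᵥ 1)

/-- `m_GCV`. -/
def mGCV : ℝ := (1 ⬝ᵥ G⁻¹ ^ 2 *ᵥ y) / (1 ⬝ᵥ G⁻¹ ^ 2 *ᵥ 1)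

/-- `s²_EB`. -/
def s2EB : ℝ := 1 / (n : ℝ) * projQuad G⁻¹ y

/-- `s²_GCV`. -/
def s2GCV : ℝ := projQuad (G⁻¹ ^ 2) y * (G⁻¹.trace)⁻¹

/-- `σ̂²_full`. -/
def sigma2Full : ℝ :=
  1 / ((n : ℝ) - 1) * projQuad G⁻¹ y *
    ((1 - c ⬝ᵥ G⁻¹ *ᵥ 1) ^ 2 / (1 ⬝ᵥ G⁻¹ *ᵥ 1) + condVar G c c₀)

/-- The objective function minimized by `θ_EB`. -/
def objEB : ℝ := Real.log (projQuad G⁻¹ y) + 1 / (n : ℝ) * Real.log G.det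

/-- The objective function minimized by `θ_GCV`. -/
def objGCV : ℝ := Real.log (projQuad (G⁻¹ ^ 2) y) - 2 * Real.log G⁻¹.trace

/-- The cubature `μ̂_EB = μ̂_full`. -/
def muEB : ℝ :=
  (((1 - 1 ⬝ᵥ G⁻¹ *ᵥ c) / (1 ⬝ᵥ G⁻¹ *ᵥ 1)) • (1 : Fin n → ℝ) + c) ⬝ᵥ G⁻¹ *ᵥ y

/-- The cubature `μ̂_GCV`. -/
def muGCV : ℝ :=
  (((1 - 1 ⬝ᵥ G⁻¹ *ᵥ c) / (1 ⬝ᵥ G⁻¹ ^ 2 *ᵥ 1)) • (G⁻¹ *ᵥ 1) + c) ⬝ᵥ G⁻¹ *ᵥ y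

/-- The half-width `a s √(c₀ - 𝐜ᵀ𝖢⁻¹𝐜)`, for the multiplier `a` and the scale `s = √s2`. -/
def errCI (a s2 : ℝ) : ℝ := a * Real.sqrt s2 * Real.sqrt (condVar G c c₀)

/-- The 99.5 percentile `z_{0.995} ≈ 2.58` of the standard normal distribution. -/
def zQ : ℝ := quantile (gaussianReal 0 1) 0.995

/-- `err_full = t_{n-1,0.995} σ̂_full`. -/
def errFull : ℝ :=
  quantile (studentT ((n : ℝ) - 1)) 0.995 * Real.sqrt (sigma2Full G y c c₀)

end Formulas

end BayesCub

end

noncomputable section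

namespace BayesCub

/-! ### Continuous densities -/

/-! Everything rests on the explicit joint law of the data `𝐟` and the integral `μ`. The delicate
point is that this law is Gaussian at all: `f` is only jointly measurable, so `μ` is not visibly a
limit of Riemann sums. By the strong law of large numbers, averages of a path over independent
uniform nodes converge to its integral, and Fubini selects one fixed sequence of nodes that works
for almost every path (`exists_tendsto_average`). Almost sure limits of Gaussian variables with a
common mean are Gaussian (`hasGaussianLaw_of_tendsto`), which applied to all linear combinations
gives joint normality. The covariances of `μ` come from Fubini again, with Cauchy-Schwarz reducing
integrability to `∫ √C(t,t) dt < ∞`. Whitening yields the density of `𝐟`; subtracting from `μ` its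
linear regression on `𝐟` leaves an independent normal remainder of variance `s² (c₀ - 𝐜ᵀ𝖢⁻¹𝐜)`,
whence the joint density (`map_dataVec_integralOf`).

The estimation statements are then completed squares: in `m` for the matrices `𝖢⁻¹` and `𝖢⁻²`
(`quad_sub_smul_one`), and in a single coordinate of `y` for leave-one-out prediction
(`quad_update`). The maximization in `s²` is the inequality `log r ≤ r - 1`.

For full Bayes, the mean is integrated out as a Gaussian and the scale as a Gamma integral, which
leaves a rescaled Student density (`lintegral_joint_prior`).

The normal percentile is enclosed by integrating alternating Taylor bounds for `exp (-t²/2)`. The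
full Bayes interval is the wider one because a Student variable rescaled by `√(n/(n-1))` has a
density whose ratio to the normal density increases with `|t|` (`integral_symm_lt`,
`rpow_mul_exp_lt`). -/

/-- Densities of the same measure agree almost everywhere, and continuous functions that agree
almost everywhere agree everywhere when open sets have positive volume. This makes the choice inside
`density` harmless. -/
theorem IsContDensity.unique {E : Type*} [TopologicalSpace E] [MeasureSpace E] [BorelSpace E]
    [SigmaFinite (volume : Measure E)] [(volume : Measure E).IsOpenPosMeasure]
    {ν : Measure E} {p q : E → ℝ} (hp : IsContDensity ν p) (hq : IsContDensity ν q) : p = q := by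
  obtain ⟨hpc, hp0, hpν⟩ := hp
  obtain ⟨hqc, hq0, hqν⟩ := hq
  have h := (withDensity_eq_iff_of_sigmaFinite (μ := (volume : Measure E))
    (by fun_prop) (by fun_prop)).1 (hpν.symm.trans hqν)
  refine (hpc.ae_eq_iff_eq volume hqc).1 ?_
  filter_upwards [h] with e he
  exact (ENNReal.ofReal_eq_ofReal_iff (hp0 e) (hq0 e)).1 he

theorem IsContDensity.density_eq {E : Type*} [TopologicalSpace E] [MeasureSpace E] [BorelSpace E]
    [SigmaFinite (volume : Measure E)] [(volume : Measure E).IsOpenPosMeasure]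
    {ν : Measure E} {p : E → ℝ} (hp : IsContDensity ν p) : density ν = p := by
  have h : ∃ p, IsContDensity ν p := ⟨p, hp⟩
  rw [density, dif_pos h]
  exact h.choose_spec.unique hp

/-! ### Changes of variables -/

theorem map_withDensity_equiv {α β : Type*} [MeasurableSpace α] [MeasurableSpace β]
    (e : α ≃ᵐ β) (μ : Measure α) {g : α → ℝ≥0∞} :
    (μ.withDensity g).map e = (μ.map e).withDensity (g ∘ e.symm) := by
  ext s hs
  rw [e.map_apply, withDensity_apply _ (e.measurable hs), withDensity_apply _ hs, e.restrict_map,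
    lintegral_map_equiv]
  simp

theorem pi_withDensity_ofReal {ι : Type*} [Fintype ι] (g : ι → ℝ → ℝ)
    (hg0 : ∀ i t, 0 ≤ g i t) (hg : ∀ i, Integrable (g i)) :
    Measure.pi (fun i => volume.withDensity fun t => ENNReal.ofReal (g i t)) =
      volume.withDensity fun w : ι → ℝ => ENNReal.ofReal (∏ i, g i (w i)) := by
  have hfin : ∀ i, IsFiniteMeasure (volume.withDensity fun t => ENNReal.ofReal (g i t)) :=
    fun i => isFiniteMeasure_withDensity_ofReal (hg i).2
  refine Measure.pi_eq fun s hs => ?_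
  have hr : (volume : Measure (ι → ℝ)).restrict (Set.univ.pi s) =
      Measure.pi fun i => (volume : Measure ℝ).restrict (s i) := by
    rw [volume_pi, Measure.restrict_pi_pi]
  rw [withDensity_apply _ (MeasurableSet.univ_pi hs), hr,
    ← ofReal_integral_eq_lintegral_ofReal, integral_fintype_prod_eq_prod,
    ENNReal.ofReal_prod_of_nonneg]
  · refine Finset.prod_congr rfl fun i _ => ?_
    rw [withDensity_apply _ (hs i), ofReal_integral_eq_lintegral_ofReal (hg i).restrict]
    exact Filter.Eventually.of_forall (hg0 i)
  · exact fun i _ => integral_nonneg (hg0 i)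
  · exact Integrable.fintype_prod fun i => (hg i).restrict
  · exact Filter.Eventually.of_forall fun w => Finset.prod_nonneg fun i _ => hg0 i _

/-! ### Density of a Gaussian vector -/

/-- The density of the normal distribution with mean `μ` and covariance matrix `S`. -/
def normalDensity {n : ℕ} (μ : Fin n → ℝ) (S : Matrix (Fin n) (Fin n) ℝ) (y : Fin n → ℝ) : ℝ :=
  (√(2 * Real.pi))⁻¹ ^ n * (√S.det)⁻¹ * Real.exp (-((y - μ) ⬝ᵥ S⁻¹ *ᵥ (y - μ)) / 2)

open scoped MatrixOrder in
theorem exists_symm_sqrt {n : ℕ} {S : Matrix (Fin n) (Fin n) ℝ} (hS : S.PosDef) :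
    ∃ B : Matrix (Fin n) (Fin n) ℝ, Bᵀ = B ∧ B * B = S ∧ 0 < B.det := by
  refine ⟨CFC.sqrt S, ?_, CFC.sqrt_mul_sqrt_self S hS.posSemidef.nonneg, ?_⟩
  · have := (nonneg_iff_posSemidef.1 (CFC.sqrt_nonneg S)).isHermitian
    simpa [IsHermitian, conjTranspose_eq_transpose_of_trivial] using this
  · rw [hS.posSemidef.det_sqrt]
    simpa using Real.sqrt_pos.2 hS.det_pos

theorem covariance_mulVec {n : ℕ} {Ω : Type*} [MeasurableSpace Ω] {P : Measure Ω}
    [IsProbabilityMeasure P] {F : Ω → Fin n → ℝ} (hF : ∀ i, MemLp (fun ω => F ω i) 2 P)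
    {S : Matrix (Fin n) (Fin n) ℝ} (hS : ∀ i j, cov[fun ω => F ω i, fun ω => F ω j; P] = S i j)
    (M : Matrix (Fin n) (Fin n) ℝ) (i j : Fin n) :
    cov[fun ω => (M *ᵥ F ω) i, fun ω => (M *ᵥ F ω) j; P] = (M * S * Mᵀ) i j := by
  simp only [mulVec, dotProduct]
  rw [covariance_fun_sum_fun_sum (fun k => (hF k).const_mul _) (fun k => (hF k).const_mul _)]
  simp only [covariance_const_mul_left, covariance_const_mul_right, hS, mul_apply,
    transpose_apply, Finset.sum_mul]
  rw [Finset.sum_comm]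
  refine Finset.sum_congr rfl fun k _ => Finset.sum_congr rfl fun l _ => ?_
  ring

/-- Whitening: with `B` the symmetric square root of `S`, the vector `B⁻¹F` is Gaussian with
identity covariance, so its coordinates are independent normals of unit variance. Mapping the
product density back by `B` costs the Jacobian `1 / det B = 1 / √(det S)`. -/
theorem map_eq_withDensity_normalDensity {n : ℕ} {Ω : Type*} [MeasurableSpace Ω] {P : Measure Ω}
    {F : Ω → Fin n → ℝ} (hFm : Measurable F) (hF : HasGaussianLaw F P) {μ : Fin n → ℝ}
    {S : Matrix (Fin n) (Fin n) ℝ} (hμ : ∀ i, ∫ ω, F ω i ∂P = μ i)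
    (hS : ∀ i j, cov[fun ω => F ω i, fun ω => F ω j; P] = S i j) (hpos : S.PosDef) :
    P.map F = volume.withDensity fun y => ENNReal.ofReal (normalDensity μ S y) := by
  have := hF.isProbabilityMeasure
  have hF2 : ∀ i, MemLp (fun ω => F ω i) 2 P := fun i =>
    (HasGaussianLaw.eval (X := fun i ω => F ω i) hF i).memLp_two
  obtain ⟨B, hBt, hBB, hdet⟩ := exists_symm_sqrt hpos
  have hu : IsUnit B.det := hdet.ne'.isUnit
  have hBi : B⁻¹ * S * (B⁻¹)ᵀ = 1 := by
    rw [transpose_nonsing_inv, hBt, ← hBB, ← Matrix.mul_assoc, nonsing_inv_mul _ hu, Matrix.one_mul,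
      mul_nonsing_inv _ hu]
  have hSi : S⁻¹ = B⁻¹ * B⁻¹ := by rw [← hBB, Matrix.mul_inv_rev]
  set W : Fin n → Ω → ℝ := fun i ω => (B⁻¹ *ᵥ F ω) i with hW
  have hWm : ∀ i, Measurable (W i) := fun i => by
    simp only [hW, mulVec, dotProduct]
    fun_prop
  have hWg : HasGaussianLaw (fun ω i => W i ω) P :=
    hF.map_fun (LinearMap.toContinuousLinearMap (Matrix.toLin' B⁻¹))
  have hWc : ∀ i j, cov[W i, W j; P] = (1 : Matrix (Fin n) (Fin n) ℝ) i j := fun i j => by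
    rw [← hBi]; exact covariance_mulVec hF2 hS B⁻¹ i j
  have hWi : iIndepFun W P := hWg.iIndepFun_of_covariance_eq_zero fun i j hij => by
    rw [hWc, one_apply_ne hij]
  have hWlaw : ∀ i, P.map (W i) = gaussianReal ((B⁻¹ *ᵥ μ) i) 1 := fun i => by
    have h := (hWg.eval i).map_eq_gaussianReal
    have hm : ∫ ω, W i ω ∂P = (B⁻¹ *ᵥ μ) i := by
      simp only [hW, mulVec, dotProduct]
      rw [integral_finsetSum _ fun k _ => ((hF2 k).integrable (by norm_num)).const_mul _]
      simp [integral_const_mul, hμ]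
    have hv : Var[W i; P] = 1 := by
      rw [← covariance_self (hWm i).aemeasurable, hWc, one_apply_eq]
    rw [h, hm, hv]; simp
  have hlaw : P.map (fun ω i => W i ω) = volume.withDensity fun w : Fin n → ℝ =>
      ENNReal.ofReal (∏ i, gaussianPDFReal ((B⁻¹ *ᵥ μ) i) 1 (w i)) := by
    rw [(iIndepFun_iff_map_fun_eq_pi_map fun i => (hWm i).aemeasurable).1 hWi,
      ← pi_withDensity_ofReal (fun i => gaussianPDFReal ((B⁻¹ *ᵥ μ) i) 1)
        (fun i t => gaussianPDFReal_nonneg _ _ _) (fun i => integrable_gaussianPDFReal _ _)]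
    congr 1
    ext1 i
    rw [hWlaw, gaussianReal_of_var_ne_zero _ one_ne_zero]
    rfl
  let e : (Fin n → ℝ) ≃L[ℝ] (Fin n → ℝ) := (Matrix.toLinearEquiv' B
    (B.invertibleOfIsUnitDet hu)).toContinuousLinearEquiv
  have he : ∀ w, e w = B *ᵥ w := fun w => by
    simp [e, LinearEquiv.coe_toContinuousLinearEquiv', ← toLin'_apply]; rfl
  have hes : ∀ w, e.symm w = B⁻¹ *ᵥ w := fun w => by
    apply e.injective
    rw [e.apply_symm_apply, he, mulVec_mulVec, mul_nonsing_inv _ hu, one_mulVec]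
  have hFe : F = (e : (Fin n → ℝ) → Fin n → ℝ) ∘ fun ω i => W i ω := by
    funext ω
    simp only [Function.comp, he, hW]
    change F ω = B *ᵥ (B⁻¹ *ᵥ F ω)
    rw [mulVec_mulVec, mul_nonsing_inv _ hu, one_mulVec]
  have hvol : (volume : Measure (Fin n → ℝ)).map e.toHomeomorph.toMeasurableEquiv =
      ENNReal.ofReal (B.det)⁻¹ • volume := by
    have h := Real.map_matrix_volume_pi_eq_smul_volume_pi (M := B) hdet.ne'
    rw [abs_of_pos (inv_pos.2 hdet)] at h
    rw [← h]
    congr 1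
  have hmap : P.map F = (P.map fun ω i => W i ω).map e.toHomeomorph.toMeasurableEquiv := by
    rw [Measure.map_map (MeasurableEquiv.measurable _) (measurable_pi_lambda _ hWm)]
    conv_lhs => rw [hFe]
    rfl
  rw [hmap, hlaw, map_withDensity_equiv, hvol, withDensity_smul_measure,
    ← withDensity_smul' _ _ (by simp)]
  congr 1
  funext y
  have hsymm : e.toHomeomorph.toMeasurableEquiv.symm y = B⁻¹ *ᵥ y := hes y
  simp only [Pi.smul_apply, Function.comp, hsymm, smul_eq_mul]
  rw [← ENNReal.ofReal_mul (inv_nonneg.2 hdet.le)]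
  congr 1
  have hq : (y - μ) ⬝ᵥ S⁻¹ *ᵥ (y - μ) = ∑ i, ((B⁻¹ *ᵥ y) i - (B⁻¹ *ᵥ μ) i) ^ 2 := by
    have h1 : (B⁻¹)ᵀ = B⁻¹ := by rw [transpose_nonsing_inv, hBt]
    rw [hSi, ← mulVec_mulVec, dotProduct_mulVec, ← mulVec_transpose, h1, mulVec_sub]
    simp [dotProduct, sq]
  have hsd : √S.det = B.det := by
    rw [← hBB, det_mul, Real.sqrt_mul_self hdet.le]
  rw [normalDensity, hq, hsd]
  simp only [gaussianPDFReal, NNReal.coe_one, mul_one, Finset.prod_mul_distrib,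
    Finset.prod_const, Finset.card_univ, Fintype.card_fin]
  rw [← Real.exp_sum, ← Finset.sum_div, Finset.sum_neg_distrib]
  ring

theorem continuous_normalDensity {n : ℕ} (μ : Fin n → ℝ) (S : Matrix (Fin n) (Fin n) ℝ) :
    Continuous (normalDensity μ S) := by
  unfold normalDensity
  have : Continuous fun y : Fin n → ℝ => S⁻¹ *ᵥ (y - μ) :=
    Continuous.matrix_mulVec continuous_const (by fun_prop)
  have h2 : Continuous fun y : Fin n → ℝ => (y - μ) ⬝ᵥ S⁻¹ *ᵥ (y - μ) :=
    Continuous.dotProduct (by fun_prop) this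
  fun_prop

theorem normalDensity_nonneg {n : ℕ} (μ : Fin n → ℝ) (S : Matrix (Fin n) (Fin n) ℝ)
    (y : Fin n → ℝ) : 0 ≤ normalDensity μ S y := by
  unfold normalDensity; positivity

theorem normalDensity_pos {n : ℕ} (μ : Fin n → ℝ) {S : Matrix (Fin n) (Fin n) ℝ} (hS : S.PosDef)
    (y : Fin n → ℝ) : 0 < normalDensity μ S y := by
  have := Real.sqrt_pos.2 hS.det_pos
  unfold normalDensity; positivity

/-! ### Limits of Gaussian random variables -/

open Filter Topology in
-- Characteristic functions converge pointwise by dominated convergence. Their moduli `exp (-vₖ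
-- t²/2)` at one point where the limit does not vanish force the variances `vₖ` to converge, so the
-- limit is the characteristic function of a normal law, possibly degenerate. The common mean `m`
-- spares a separate argument for the convergence of means.
theorem hasGaussianLaw_of_tendsto {Ω : Type*} [MeasurableSpace Ω] {P : Measure Ω}
    [IsProbabilityMeasure P] {X : ℕ → Ω → ℝ} {Y : Ω → ℝ} {m : ℝ}
    (hX : ∀ k, HasGaussianLaw (X k) P) (hm : ∀ k, ∫ ω, X k ω ∂P = m) (hY : AEMeasurable Y P)
    (h : ∀ᵐ ω ∂P, Tendsto (fun k => X k ω) atTop (𝓝 (Y ω))) : HasGaussianLaw Y P := by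
  have : IsProbabilityMeasure (P.map Y) := Measure.isProbabilityMeasure_map hY
  set v : ℕ → ℝ := fun k => Var[X k; P] with hv
  have hchar : ∀ k (t : ℝ), charFun (P.map (X k)) t =
      Complex.exp (t * m * Complex.I - v k * t ^ 2 / 2) := fun k t => by
    rw [(hX k).map_eq_gaussianReal, charFun_gaussianReal, hm,
      Real.coe_toNNReal _ (variance_nonneg _ _)]
  have hlim : ∀ t : ℝ, Tendsto (fun k => charFun (P.map (X k)) t) atTop
      (𝓝 (charFun (P.map Y) t)) := fun t => by
    have e : ∀ Z : Ω → ℝ, AEMeasurable Z P →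
        charFun (P.map Z) t = ∫ ω, Complex.exp (t * Z ω * Complex.I) ∂P := fun Z hZ => by
      rw [charFun_apply_real, integral_map hZ (by fun_prop)]
    rw [e Y hY]
    simp_rw [fun k => e (X k) (hX k).aemeasurable]
    refine tendsto_integral_of_dominated_convergence (fun _ => 1) (fun k => ?_)
      (integrable_const _) (fun k => ae_of_all _ fun ω => ?_) ?_
    · have := (hX k).aemeasurable
      exact AEMeasurable.aestronglyMeasurable (by fun_prop)
    · have := Complex.norm_exp_ofReal_mul_I (t * X k ω)
      push_cast at this
      exact this.le
    · filter_upwards [h] with ω hω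
      have : Continuous fun z : ℝ => Complex.exp (t * z * Complex.I) := by fun_prop
      exact (this.tendsto _).comp hω
  have hnorm : ∀ k (t : ℝ), ‖charFun (P.map (X k)) t‖ = Real.exp (-(v k * t ^ 2 / 2)) := by
    intro k t
    rw [hchar, Complex.norm_exp]
    congr 1
    have : ((t * m * Complex.I - v k * t ^ 2 / 2 : ℂ)) =
      ((-(v k * t ^ 2 / 2) : ℝ) : ℂ) + ((t * m : ℝ) : ℂ) * Complex.I := by push_cast; ring
    rw [this]
    simp only [Complex.add_re, Complex.ofReal_re, Complex.re_ofReal_mul, Complex.I_re, mul_zero,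
      add_zero]
  -- The limit is continuous and equals 1 at 0, so it does not vanish near 0.
  obtain ⟨t, ht0, ht⟩ : ∃ t : ℝ, 0 < t ∧ charFun (P.map Y) t ≠ 0 := by
    have hc : ∀ᶠ t in 𝓝 (0 : ℝ), charFun (P.map Y) t ≠ 0 := by
      refine (continuous_charFun (μ := P.map Y)).continuousAt.eventually_ne ?_
      simp
    obtain ⟨ε, hε, hb⟩ := Metric.eventually_nhds_iff.1 hc
    refine ⟨ε / 2, by positivity, hb ?_⟩
    rw [Real.dist_eq, sub_zero, abs_of_pos (by positivity)]
    linarith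
  have hvlim : Tendsto v atTop (𝓝 (-2 * Real.log ‖charFun (P.map Y) t‖ / t ^ 2)) := by
    have h1 := (((hlim t).norm.log (norm_ne_zero_iff.2 ht)).const_mul (-2)).div_const (t ^ 2)
    refine h1.congr fun k => ?_
    rw [hnorm, Real.log_exp]
    field_simp
  set w := -2 * Real.log ‖charFun (P.map Y) t‖ / t ^ 2 with hw
  have hw0 : 0 ≤ w := ge_of_tendsto' hvlim fun k => variance_nonneg _ _
  have hlaw : P.map Y = gaussianReal m w.toNNReal := by
    refine Measure.ext_of_charFun (funext fun s => ?_)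
    rw [charFun_gaussianReal, Real.coe_toNNReal _ hw0]
    refine tendsto_nhds_unique (hlim s) ?_
    simp_rw [hchar]
    have : Continuous fun z : ℝ => Complex.exp (s * m * Complex.I - z * s ^ 2 / 2) := by fun_prop
    exact (this.tendsto w).comp hvlim
  exact ⟨by rw [hlaw]; infer_instance⟩

/-! ### Empirical averages of an integrable function -/

open Filter Topology in
theorem ae_tendsto_average {X : Type*} [MeasureSpace X]
    [IsProbabilityMeasure (volume : Measure X)] {g : X → ℝ} (hg : Measurable g)
    (hi : Integrable g) :
    ∀ᵐ T ∂Measure.infinitePi fun _ : ℕ => (volume : Measure X),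
      Tendsto (fun k : ℕ => (∑ i ∈ Finset.range k, g (T i)) / k) atTop (𝓝 (∫ t, g t)) := by
  have hev : ∀ i : ℕ, Measurable fun T : ℕ → X => T i := fun i => measurable_pi_apply i
  have hmp := fun i => measurePreserving_eval_infinitePi (fun _ : ℕ => (volume : Measure X)) i
  have h := strong_law_ae_real (μ := Measure.infinitePi fun _ : ℕ => (volume : Measure X))
    (fun i T => g (T i)) ((hmp 0).integrable_comp_of_integrable hi)
    (fun i j hij => (iIndepFun_infinitePi (fun _ : ℕ => hg)).indepFun hij) fun i =>
      ⟨(hg.comp (hev i)).aemeasurable, (hg.comp (hev 0)).aemeasurable, by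
        have e : ∀ i, Measure.map (fun T : ℕ → X => g (T i))
            (Measure.infinitePi fun _ => volume) = volume.map g := fun i => by
          rw [← (hmp i).map_eq, Measure.map_map hg (hmp i).measurable, (hmp i).map_eq]; rfl
        rw [e, e]⟩
  have h0 : ∫ T, g (T 0) ∂(Measure.infinitePi fun _ : ℕ => (volume : Measure X)) = ∫ t, g t := by
    have e := integral_map (φ := fun T : ℕ → X => T 0)
      (μ := Measure.infinitePi fun _ => (volume : Measure X)) (hmp 0).measurable.aemeasurable
      hg.aestronglyMeasurable
    rw [show Measure.map (fun T : ℕ → X => T 0) _ = _ from (hmp 0).map_eq] at e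
    exact e.symm
  rwa [h0] at h

/-! ### Moments of a Gaussian process and of its integral -/

theorem sqrt_add_sq_le {a : ℝ} (m : ℝ) (ha : 0 ≤ a) : √(a + m ^ 2) ≤ √a + |m| := by
  refine Real.sqrt_le_iff.2 ⟨by positivity, ?_⟩
  nlinarith [Real.sq_sqrt ha, sq_abs m, mul_nonneg (Real.sqrt_nonneg a) (abs_nonneg m)]

namespace IsGP

section Moments

variable {X Ω : Type*} [MeasurableSpace Ω] {P : Measure Ω} {f : X → Ω → ℝ}
  {m : ℝ} {K : X → X → ℝ}

theorem memLp_two (h : IsGP P f m K) (t : X) : MemLp (f t) 2 P :=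
  (h.gaussian.hasGaussianLaw_eval t).memLp_two

theorem integral_mul (h : IsGP P f m K) (t u : X) : ∫ ω, f t ω * f u ω ∂P = K t u + m ^ 2 := by
  have := h.gaussian.isProbabilityMeasure
  have hc := covariance_eq_sub (h.memLp_two t) (h.memLp_two u)
  rw [h.cov, h.mean, h.mean] at hc
  simp only [Pi.mul_apply] at hc
  linarith

theorem diag_nonneg (h : IsGP P f m K) (t : X) : 0 ≤ K t t := by
  rw [← h.cov, covariance_self (h.gaussian.aemeasurable t)]
  exact variance_nonneg _ _

/-- Cauchy-Schwarz, with the bound split into a factor in `t` and a factor in `u`. Integrability of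
`√(K t t)` alone then controls both the single and the double integrals over the cube. -/
theorem integral_abs_mul_le (h : IsGP P f m K) (t u : X) :
    ∫ ω, ‖f t ω * f u ω‖ ∂P ≤ (√(K t t) + |m|) * (√(K u u) + |m|) := by
  have hsq : ∀ t, (∫ ω, |f t ω| ^ (2 : ℝ) ∂P) ^ (1 / (2 : ℝ)) ≤ √(K t t) + |m| := fun t => by
    rw [← Real.sqrt_eq_rpow]
    have : ∫ ω, |f t ω| ^ (2 : ℝ) ∂P = K t t + m ^ 2 := by
      rw [← h.integral_mul]
      refine integral_congr_ae (ae_of_all _ fun ω => ?_)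
      simp [sq]
    rw [this]
    exact sqrt_add_sq_le _ (h.diag_nonneg t)
  have hH := integral_mul_le_Lp_mul_Lq_of_nonneg (μ := P) (p := 2) (q := 2)
    Real.HolderConjugate.two_two (f := fun ω => |f t ω|) (g := fun ω => |f u ω|)
    (ae_of_all _ fun ω => abs_nonneg _) (ae_of_all _ fun ω => abs_nonneg _)
    (by simpa using (h.memLp_two t).norm) (by simpa using (h.memLp_two u).norm)
  simp only [Real.norm_eq_abs, abs_mul]
  refine hH.trans (mul_le_mul (hsq t) (hsq u) (by positivity) (by positivity))

theorem integral_abs_le (h : IsGP P f m K) (t : X) :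
    ∫ ω, ‖f t ω‖ ∂P ≤ √(K t t) + |m| := by
  have := h.gaussian.isProbabilityMeasure
  have hi := h.memLp_two t
  have h1 : (∫ ω, ‖f t ω‖ ∂P) ^ 2 ≤ K t t + m ^ 2 := by
    have hv := variance_nonneg (fun ω => ‖f t ω‖) P
    rw [variance_eq_sub hi.norm] at hv
    have : ∫ ω, ((fun ω => ‖f t ω‖) ^ 2) ω ∂P = K t t + m ^ 2 := by
      rw [← h.integral_mul]
      refine integral_congr_ae (ae_of_all _ fun ω => ?_)
      simp [sq]
    linarith
  calc ∫ ω, ‖f t ω‖ ∂P ≤ √(K t t + m ^ 2) := Real.le_sqrt_of_sq_le h1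
    _ ≤ √(K t t) + |m| := sqrt_add_sq_le _ (h.diag_nonneg t)

/-- The maps `a` and `b` allow one statement to serve both uses of Fubini: `(t, u)` with `u` fixed
for the covariance of `f u` with the integral, and the two projections of the square for the
variance. -/
theorem integrable_mul_comp [MeasurableSpace X] (h : IsGP P f m K)
    (hf : Measurable (Function.uncurry f)) {S : Type*} [MeasurableSpace S] {σ : Measure S}
    [SFinite σ] {a b : S → X} (ha : Measurable a) (hb : Measurable b)
    (hi : Integrable (fun s => (√(K (a s) (a s)) + |m|) * (√(K (b s) (b s)) + |m|)) σ) :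
    Integrable (fun p : S × Ω => f (a p.1) p.2 * f (b p.1) p.2) (σ.prod P) := by
  have := h.gaussian.isProbabilityMeasure
  have hm : ∀ {a : S → X}, Measurable a → Measurable fun p : S × Ω => f (a p.1) p.2 :=
    fun ha => hf.comp (by fun_prop : Measurable fun p : S × Ω => (_, p.2))
  have hmm : AEStronglyMeasurable (fun p : S × Ω => f (a p.1) p.2 * f (b p.1) p.2) (σ.prod P) :=
    ((hm ha).mul (hm hb)).aestronglyMeasurable
  rw [integrable_prod_iff hmm]
  refine ⟨ae_of_all _ fun s => (h.memLp_two (a s)).integrable_mul (h.memLp_two (b s)),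
    hi.mono' hmm.norm.integral_prod_right' (ae_of_all _ fun s => ?_)⟩
  rw [Real.norm_of_nonneg (integral_nonneg fun ω => norm_nonneg _)]
  exact h.integral_abs_mul_le (a s) (b s)

end Moments

section Integral

variable {d n : ℕ} {Ω : Type*} [MeasurableSpace Ω] {P : Measure Ω} {f : Cube d → Ω → ℝ}
  {m : ℝ} {K : Cube d → Cube d → ℝ}

theorem measurable_integralOf (hf : Measurable (Function.uncurry f)) :
    Measurable (integralOf f) := by
  have : Measurable (Function.uncurry fun ω t => f t ω) := hf.comp measurable_swap
  exact (this.stronglyMeasurable.integral_prod_right (ν := volume)).measurable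

theorem measurable_dataVec (hf : Measurable (Function.uncurry f)) (x : Fin n → Cube d) :
    Measurable (dataVec f x) :=
  measurable_pi_lambda _ fun _ => hf.of_uncurry_left

theorem integrable_uncurry (h : IsGP P f m K) (hf : Measurable (Function.uncurry f))
    (hK : Integrable fun t => √(K t t)) :
    Integrable (Function.uncurry f) ((volume : Measure (Cube d)).prod P) := by
  have := h.gaussian.isProbabilityMeasure
  have hmm := hf.aestronglyMeasurable (μ := (volume : Measure (Cube d)).prod P)
  rw [integrable_prod_iff hmm]
  refine ⟨ae_of_all _ fun t => (h.memLp_two t).integrable (by norm_num),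
    (hK.add (integrable_const |m|)).mono' hmm.norm.integral_prod_right' (ae_of_all _ fun t => ?_)⟩
  rw [Real.norm_of_nonneg (integral_nonneg fun ω => norm_nonneg _)]
  exact h.integral_abs_le t

theorem ae_integrable (h : IsGP P f m K) (hf : Measurable (Function.uncurry f))
    (hK : Integrable fun t => √(K t t)) : ∀ᵐ ω ∂P, Integrable fun t => f t ω := by
  have := h.gaussian.isProbabilityMeasure
  exact (h.integrable_uncurry hf hK).prod_left_ae

theorem integral_integralOf (h : IsGP P f m K) (hf : Measurable (Function.uncurry f))
    (hK : Integrable fun t => √(K t t)) : ∫ ω, integralOf f ω ∂P = m := by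
  have := h.gaussian.isProbabilityMeasure
  simp only [integralOf]
  rw [← integral_integral_swap (h.integrable_uncurry hf hK)]
  simp [h.mean]

open Filter Topology in
-- For almost every path, almost every node sequence works, by the strong law. Exchanging the two
-- quantifiers, which needs the measurability `hms`, gives a deterministic node sequence valid for
-- almost all paths.
theorem exists_tendsto_average (h : IsGP P f m K) (hf : Measurable (Function.uncurry f))
    (hK : Integrable fun t => √(K t t)) :
    ∃ T : ℕ → Cube d, ∀ᵐ ω ∂P,
      Tendsto (fun k : ℕ => (∑ i ∈ Finset.range k, f (T i) ω) / k) atTop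
        (𝓝 (integralOf f ω)) := by
  have := h.gaussian.isProbabilityMeasure
  have hms : MeasurableSet {p : (ℕ → Cube d) × Ω |
      Tendsto (fun k : ℕ => (∑ i ∈ Finset.range k, f (p.1 i) p.2) / k) atTop
        (𝓝 (integralOf f p.2))} := by
    refine measurableSet_tendsto_fun (fun k => ?_) ((measurable_integralOf hf).comp measurable_snd)
    refine Measurable.div_const (Finset.measurable_fun_sum _ fun i _ => ?_) _
    exact hf.comp (by fun_prop : Measurable fun p : (ℕ → Cube d) × Ω => (p.1 i, p.2))
  have hae : ∀ᵐ ω ∂P, ∀ᵐ T ∂Measure.infinitePi fun _ : ℕ => (volume : Measure (Cube d)),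
      Tendsto (fun k : ℕ => (∑ i ∈ Finset.range k, f (T i) ω) / k) atTop
        (𝓝 (integralOf f ω)) := by
    filter_upwards [h.ae_integrable hf hK] with ω hω
    exact ae_tendsto_average hf.of_uncurry_right hω
  exact ((Measure.ae_ae_comm hms).2 hae).exists

theorem hasGaussianLaw_linearCombination (h : IsGP P f m K)
    (hf : Measurable (Function.uncurry f)) (hK : Integrable fun t => √(K t t))
    (x : Fin n → Cube d) (l : Fin n → ℝ) (a : ℝ) :
    HasGaussianLaw (fun ω => ∑ i, l i * f (x i) ω + a * integralOf f ω) P := by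
  have := h.gaussian.isProbabilityMeasure
  obtain ⟨T, hT⟩ := h.exists_tendsto_average hf hK
  have hi : ∀ t, Integrable (f t) P := fun t => (h.memLp_two t).integrable (by norm_num)
  -- The average runs over `k + 1` nodes: an empty average would be 0 and would not have mean `m`.
  refine hasGaussianLaw_of_tendsto (m := ∑ i, l i * m + a * m) (X := fun k ω =>
    ∑ i, l i * f (x i) ω + a * ((∑ j ∈ Finset.range (k + 1), f (T j) ω) / (k + 1 : ℕ)))
    (fun k => ?_) (fun k => ?_) ?_ ?_
  · have hg := ((h.gaussian.comp_right (Sum.elim x T)).smul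
      (Sum.elim l fun _ => a / ((k + 1 : ℕ) : ℝ))).hasGaussianLaw_fun_sum
      (I := Finset.univ.disjSum (Finset.range (k + 1)))
    refine hg.congr (ae_of_all _ fun ω => ?_)
    simp only [Finset.sum_disjSum, Sum.elim_inl, Sum.elim_inr, Function.comp, smul_eq_mul,
      ← Finset.mul_sum]
    ring
  · rw [integral_add (integrable_finsetSum _ fun i _ => (hi _).const_mul _)
      (((integrable_finsetSum _ fun i _ => hi _).div_const _).const_mul _),
      integral_finsetSum _ fun i _ => (hi _).const_mul _, integral_const_mul, integral_div,
      integral_finsetSum _ fun i _ => hi _]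
    simp only [integral_const_mul, h.mean, Finset.sum_const, Finset.card_range, nsmul_eq_mul]
    have : ((k + 1 : ℕ) : ℝ) ≠ 0 := by positivity
    rw [mul_div_cancel_left₀ _ this]
  · have h1 : Measurable (integralOf f) := measurable_integralOf hf
    have h2 : ∀ t, Measurable (f t) := fun t => hf.of_uncurry_left
    exact Measurable.aemeasurable (by fun_prop)
  · filter_upwards [hT] with ω hω
    exact (((Filter.tendsto_add_atTop_iff_nat 1).2 hω).const_mul a).const_add _

theorem hasGaussianLaw_dataVec_integralOf (h : IsGP P f m K)
    (hf : Measurable (Function.uncurry f)) (hK : Integrable fun t => √(K t t))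
    (x : Fin n → Cube d) :
    HasGaussianLaw (fun ω => (dataVec f x ω, integralOf f ω)) P := by
  have hm : Measurable fun ω => (dataVec f x ω, integralOf f ω) :=
    (measurable_dataVec hf x).prodMk (measurable_integralOf hf)
  refine ⟨isGaussian_of_isGaussian_map fun L => ?_⟩
  rw [Measure.map_map (by fun_prop) hm]
  have hg := h.hasGaussianLaw_linearCombination hf hK x
    (fun i => L (Pi.single i 1, 0)) (L (0, 1))
  have he : (L ∘ fun ω => (dataVec f x ω, integralOf f ω)) =
      fun ω => ∑ i, L (Pi.single i 1, 0) * f (x i) ω + L (0, 1) * integralOf f ω := by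
    funext ω
    have h1 : (dataVec f x ω, integralOf f ω) =
        ∑ i, f (x i) ω • ((Pi.single i 1, 0) : (Fin n → ℝ) × ℝ) +
          integralOf f ω • ((0, 1) : (Fin n → ℝ) × ℝ) := by
      ext i
      · simp [dataVec, Prod.fst_sum, Finset.sum_apply, Pi.single_apply]
      · simp [Prod.snd_sum]
    rw [Function.comp, h1, map_add, map_sum, map_smul]
    simp only [map_smul, smul_eq_mul, mul_comm]
  rw [he]
  exact hg.isGaussian_map

theorem memLp_two_integralOf (h : IsGP P f m K) (hf : Measurable (Function.uncurry f))
    (hK : Integrable fun t => √(K t t)) : MemLp (integralOf f) 2 P :=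
  -- The empty design suffices, since only the integral component is used.
  (h.hasGaussianLaw_dataVec_integralOf hf hK (Fin.elim0 : Fin 0 → Cube d)).snd.memLp_two

/-- Integrability of `K t u` in `t` is not a hypothesis: up to the constant `m²`, this function is
the expectation of `f t * f u`, which is integrable on the product space. -/
theorem covariance_integralOf (h : IsGP P f m K) (hf : Measurable (Function.uncurry f))
    (hK : Integrable fun t => √(K t t)) (u : Cube d) :
    cov[f u, integralOf f; P] = ∫ t, K t u := by
  have := h.gaussian.isProbabilityMeasure
  have hprod := h.integrable_mul_comp hf (σ := volume) (a := id) (b := fun _ => u) measurable_id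
    measurable_const ((hK.add (integrable_const |m|)).mul_const _)
  rw [covariance_eq_sub (h.memLp_two u) (h.memLp_two_integralOf hf hK), h.mean,
    h.integral_integralOf hf hK]
  have h1 : ∫ ω, (f u * integralOf f) ω ∂P = ∫ t, (K t u + m ^ 2) := by
    have : ∀ ω, (f u * integralOf f) ω = ∫ t, f t ω * f u ω := fun ω => by
      rw [integral_mul_const, Pi.mul_apply, mul_comm]; rfl
    simp_rw [this, ← h.integral_mul]
    exact (integral_integral_swap hprod).symm
  have hKi : Integrable fun t => K t u := by
    have := hprod.integral_prod_left
    simp only [id, h.integral_mul] at this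
    exact (this.sub (integrable_const (m ^ 2))).congr (ae_of_all _ fun _ => by simp)
  rw [h1, integral_add hKi (integrable_const _)]
  simp [sq]

theorem variance_integralOf (h : IsGP P f m K) (hf : Measurable (Function.uncurry f))
    (hK : Integrable fun t => √(K t t)) : Var[integralOf f; P] = c0 K := by
  have := h.gaussian.isProbabilityMeasure
  have hb := hK.add (integrable_const |m|)
  have hprod := h.integrable_mul_comp hf (σ := (volume : Measure (Cube d × Cube d)))
    measurable_fst measurable_snd (hb.mul_prod hb)
  rw [variance_eq_sub (h.memLp_two_integralOf hf hK), h.integral_integralOf hf hK]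
  have h1 : ∫ ω, (integralOf f ^ 2) ω ∂P = ∫ p : Cube d × Cube d, (K p.1 p.2 + m ^ 2) := by
    have : ∀ ω, (integralOf f ^ 2) ω = ∫ p : Cube d × Cube d, f p.1 ω * f p.2 ω := fun ω => by
      rw [Pi.pow_apply, sq]
      exact (integral_prod_mul (fun t => f t ω) fun t => f t ω).symm
    simp_rw [this, ← h.integral_mul]
    exact (integral_integral_swap hprod).symm
  have hKi : Integrable fun p : Cube d × Cube d => K p.1 p.2 := by
    have := hprod.integral_prod_left
    simp only [h.integral_mul] at this
    exact (this.sub (integrable_const (m ^ 2))).congr (ae_of_all _ fun _ => by simp)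
  rw [h1, integral_add hKi (integrable_const _), c0]
  simp

end Integral

end IsGP

/-! ### Densities of the data and of the pair of data and integral -/

theorem IsPosDefKernel.posDef_gram {d n : ℕ} {C : Cube d → Cube d → ℝ} (hC : IsPosDefKernel C)
    {x : Fin n → Cube d} (hx : Function.Injective x) : (gram C x).PosDef := hC n x hx

theorem shear_measurePreserving {n : ℕ} (w : Fin n → ℝ) :
    MeasurePreserving (fun p : (Fin n → ℝ) × ℝ => (p.1, p.2 + w ⬝ᵥ p.1)) := by
  have hm : Measurable fun p : (Fin n → ℝ) × ℝ => p.2 + w ⬝ᵥ p.1 := by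
    simp only [dotProduct]; fun_prop
  exact (MeasurePreserving.id (volume : Measure (Fin n → ℝ))).skew_product
    (g := fun y z => z + w ⬝ᵥ y) hm
    (ae_of_all _ fun y => (measurePreserving_add_right volume (w ⬝ᵥ y)).map_eq)

/-- The shear `(y, z) ↦ (y, z + ⟨w, y⟩)`. -/
def shear {n : ℕ} (w : Fin n → ℝ) : ((Fin n → ℝ) × ℝ) ≃ᵐ ((Fin n → ℝ) × ℝ) where
  toFun p := (p.1, p.2 + w ⬝ᵥ p.1)
  invFun p := (p.1, p.2 - w ⬝ᵥ p.1)
  left_inv p := by simp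
  right_inv p := by simp
  measurable_toFun := (shear_measurePreserving w).measurable
  measurable_invFun := by
    change Measurable fun p : (Fin n → ℝ) × ℝ => (p.1, p.2 - w ⬝ᵥ p.1)
    simp only [dotProduct]
    fun_prop

namespace IsGP

variable {d n : ℕ} {Ω : Type*} [MeasurableSpace Ω] {P : Measure Ω} {f : Cube d → Ω → ℝ}
  {m s2 : ℝ} {C : Cube d → Cube d → ℝ}

theorem integrable_sqrt_diag (hC : Integrable fun t => √(C t t)) (hs : 0 < s2) :
    Integrable fun t => √(s2 * C t t) := by
  simp_rw [Real.sqrt_mul hs.le]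
  exact hC.const_mul _

theorem map_dataVec (h : IsGP P f m fun t u => s2 * C t u) (hs : 0 < s2)
    (hf : Measurable (Function.uncurry f)) (hC : Integrable fun t => √(C t t))
    {x : Fin n → Cube d} (hG : (gram C x).PosDef) :
    P.map (dataVec f x) = volume.withDensity fun y =>
      ENNReal.ofReal (normalDensity (fun _ => m) (s2 • gram C x) y) :=
  map_eq_withDensity_normalDensity (measurable_dataVec hf x)
    (h.hasGaussianLaw_dataVec_integralOf hf (integrable_sqrt_diag hC hs) x).fst
    (fun i => h.mean (x i)) (fun i j => h.cov (x i) (x j)) (hG.smul hs)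

theorem likelihood_eq (h : IsGP P f m fun t u => s2 * C t u) (hs : 0 < s2)
    (hf : Measurable (Function.uncurry f)) (hC : Integrable fun t => √(C t t))
    {x : Fin n → Cube d} (hG : (gram C x).PosDef) (y : Fin n → ℝ) :
    likelihood P f x y = normalDensity (fun _ => m) (s2 • gram C x) y := by
  rw [likelihood, IsContDensity.density_eq ⟨continuous_normalDensity _ _, normalDensity_nonneg _ _,
    h.map_dataVec hs hf hC hG⟩]

/-- With `w = 𝖢⁻¹𝐜`, the residual `R = μ - wᵀ𝐟` is uncorrelated with `𝐟`, hence independent of it by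
joint normality. The pair `(𝐟, R)` therefore has a product density, and the shear that restores `μ`
preserves volume. -/
theorem map_dataVec_integralOf (h : IsGP P f m fun t u => s2 * C t u) (hs : 0 < s2)
    (hf : Measurable (Function.uncurry f)) (hC : Integrable fun t => √(C t t))
    {x : Fin n → Cube d} (hG : (gram C x).PosDef)
    (hv : 0 < condVar (gram C x) (cVec C x) (c0 C)) :
    P.map (fun ω => (dataVec f x ω, integralOf f ω)) = volume.withDensity fun p =>
      ENNReal.ofReal (normalDensity (fun _ => m) (s2 • gram C x) p.1 *
        gaussianPDFReal (m + cVec C x ⬝ᵥ (gram C x)⁻¹ *ᵥ (p.1 - m • 1))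
          (s2 * condVar (gram C x) (cVec C x) (c0 C)).toNNReal p.2) := by
  have hK := integrable_sqrt_diag hC hs
  have := h.gaussian.isProbabilityMeasure
  set G := gram C x with hGdef
  set c := cVec C x with hc
  set v := condVar G c (c0 C) with hvdef
  have hsymm : (G⁻¹)ᵀ = G⁻¹ := by
    have := hG.inv.isHermitian
    simpa [IsHermitian, conjTranspose_eq_transpose_of_trivial] using this
  have hunit : IsUnit G.det := hG.det_pos.ne'.isUnit
  set w : Fin n → ℝ := G⁻¹ *ᵥ c with hw
  have hwc : ∀ u : Fin n → ℝ, c ⬝ᵥ G⁻¹ *ᵥ u = w ⬝ᵥ u := fun u => by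
    rw [dotProduct_mulVec, ← mulVec_transpose, hsymm]
  have hGw : G *ᵥ w = c := by rw [hw, mulVec_mulVec, mul_nonsing_inv _ hunit, one_mulVec]
  set F : Fin n → Ω → ℝ := fun i ω => f (x i) ω with hF
  set R : Ω → ℝ := fun ω => integralOf f ω - ∑ j, w j * F j ω with hR
  have hF2 : ∀ i, MemLp (F i) 2 P := fun i => h.memLp_two _
  have hμ2 := h.memLp_two_integralOf hf hK
  have hS2 : MemLp (fun ω => ∑ j, w j * F j ω) 2 P :=
    memLp_finsetSum _ fun j _ => (hF2 j).const_mul _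
  have hcovμ : ∀ i, cov[F i, integralOf f; P] = s2 * c i := fun i => by
    rw [h.covariance_integralOf hf hK, integral_const_mul]; rfl
  have hcovS : ∀ i, cov[F i, fun ω => ∑ j, w j * F j ω; P] = s2 * c i := fun i => by
    rw [covariance_fun_sum_right (fun j => (hF2 j).const_mul _) (hF2 i)]
    simp only [covariance_const_mul_right]
    have : ∀ j, cov[F i, F j; P] = s2 * G i j := fun j => h.cov _ _
    simp only [this]
    rw [← hGw, mulVec, dotProduct, Finset.mul_sum]
    exact Finset.sum_congr rfl fun j _ => by ring
  have hcovR : ∀ i, cov[F i, R; P] = 0 := fun i => by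
    rw [hR, covariance_fun_sub_right (hF2 i) hμ2 hS2, hcovμ, hcovS, sub_self]
  have hR2 : MemLp R 2 P := hμ2.sub hS2
  have hRm : Measurable R := by
    have h1 : Measurable (integralOf f) := measurable_integralOf hf
    have h2 : ∀ t, Measurable (f t) := fun t => hf.of_uncurry_left
    simp only [hR, hF]
    fun_prop
  -- The regression part is uncorrelated with `R`, so the variance of `R` is its covariance with
  -- `μ`, namely `s2 * c₀ - s2 * cᵀG⁻¹c`.
  have hvarR : Var[R; P] = s2 * v := by
    have h0 : cov[fun ω => ∑ j, w j * F j ω, R; P] = 0 := by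
      rw [covariance_fun_sum_left (fun j => (hF2 j).const_mul _) hR2]
      simp [covariance_const_mul_left, hcovR]
    have hSμ : cov[fun ω => ∑ j, w j * F j ω, integralOf f; P] = s2 * (c ⬝ᵥ G⁻¹ *ᵥ c) := by
      rw [covariance_fun_sum_left (fun j => (hF2 j).const_mul _) hμ2, hwc]
      simp only [covariance_const_mul_left, hcovμ, dotProduct, Finset.mul_sum]
      exact Finset.sum_congr rfl fun j _ => by ring
    have hc0 : c0 (fun t u => s2 * C t u) = s2 * c0 C := by simp only [c0, integral_const_mul]
    rw [← covariance_self hRm.aemeasurable]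
    conv_lhs => arg 1; rw [hR]
    rw [covariance_fun_sub_left hμ2 hS2 hR2, h0, covariance_comm]
    rw [hR, covariance_fun_sub_left hμ2 hS2 hμ2, hSμ,
      covariance_self (measurable_integralOf hf).aemeasurable, h.variance_integralOf hf hK, hc0,
      hvdef, condVar]
    ring
  have hmeanR : ∫ ω, R ω ∂P = m - w ⬝ᵥ (m • 1) := by
    have hFi : ∀ i, Integrable (F i) P := fun i => (hF2 i).integrable (by norm_num)
    rw [hR, integral_sub (hμ2.integrable (by norm_num)) (hS2.integrable (by norm_num)),
      h.integral_integralOf hf hK, integral_finsetSum _ fun i _ => (hFi i).const_mul _]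
    have : ∀ i, ∫ ω, F i ω ∂P = m := fun i => h.mean _
    simp [integral_const_mul, this, dotProduct]
  have hgauss := h.hasGaussianLaw_dataVec_integralOf hf hK x
  let L : ((Fin n → ℝ) × ℝ) →L[ℝ] ℝ :=
    ContinuousLinearMap.snd ℝ _ _ - (∑ j, w j • (ContinuousLinearMap.proj j :
      (Fin n → ℝ) →L[ℝ] ℝ)).comp (ContinuousLinearMap.fst ℝ _ _)
  have hL : ∀ ω, L (dataVec f x ω, integralOf f ω) = R ω := fun ω => by
    simp [L, hR, hF, dataVec]
  have hRg : HasGaussianLaw R P := by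
    have := hgauss.map_fun L
    simpa only [hL] using this
  have hRlaw : P.map R = gaussianReal (m - w ⬝ᵥ (m • 1)) (s2 * v).toNNReal := by
    rw [hRg.map_eq_gaussianReal, hmeanR, hvarR]
  have hind : IndepFun (dataVec f x) R P := by
    -- The independence criterion concerns two families of real variables, so `R` is regarded as a
    -- family indexed by `Unit`.
    have hg2 := hgauss.map_fun ((ContinuousLinearMap.fst ℝ _ _).prod
      (ContinuousLinearMap.pi fun _ : Unit => L))
    have hg3 : HasGaussianLaw (fun ω => (fun i => F i ω, fun _ : Unit => R ω)) P := by
      refine hg2.congr (ae_of_all _ fun ω => ?_)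
      ext i
      · rfl
      · exact hL ω
    have hi := hg3.indepFun_of_covariance_eval (X := F) (Y := fun _ : Unit => R)
      fun i _ => hcovR i
    exact hi.comp measurable_id (measurable_pi_apply ())
  have hsv : (s2 * v).toNNReal ≠ 0 := by
    rw [Ne, Real.toNNReal_eq_zero, not_le]; positivity
  have hjoint : P.map (fun ω => (dataVec f x ω, R ω)) =
      (volume : Measure ((Fin n → ℝ) × ℝ)).withDensity fun p =>
        ENNReal.ofReal (normalDensity (fun _ => m) (s2 • G) p.1) *
          gaussianPDF (m - w ⬝ᵥ (m • 1)) (s2 * v).toNNReal p.2 := by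
    rw [(indepFun_iff_map_prod_eq_prod_map_map (measurable_dataVec hf x).aemeasurable
      hRm.aemeasurable).1 hind, hRlaw, gaussianReal_of_var_ne_zero _ hsv, h.map_dataVec hs hf hC hG,
      prod_withDensity ((continuous_normalDensity _ _).measurable.ennreal_ofReal)
        (measurable_gaussianPDF _ _)]
    rfl
  have hmap : P.map (fun ω => (dataVec f x ω, integralOf f ω)) =
      (P.map fun ω => (dataVec f x ω, R ω)).map (shear w) := by
    rw [Measure.map_map (shear w).measurable ((measurable_dataVec hf x).prodMk hRm)]
    congr 1
    funext ω
    refine Prod.ext rfl ?_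
    change integralOf f ω = R ω + w ⬝ᵥ dataVec f x ω
    simp [hR, hF, dataVec, dotProduct]
  have hvol : (volume : Measure ((Fin n → ℝ) × ℝ)).map (shear w) = volume :=
    (shear_measurePreserving w).map_eq
  rw [hmap, hjoint, map_withDensity_equiv, hvol]
  congr 1
  funext p
  change ENNReal.ofReal (normalDensity (fun _ => m) (s2 • G) p.1) *
    gaussianPDF _ _ (p.2 - w ⬝ᵥ p.1) = _
  rw [gaussianPDF, ← ENNReal.ofReal_mul (normalDensity_nonneg _ _ _), gaussianPDFReal_sub, hwc,
    dotProduct_sub]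
  congr 3
  ring

theorem jointDensity_eq (h : IsGP P f m fun t u => s2 * C t u) (hs : 0 < s2)
    (hf : Measurable (Function.uncurry f)) (hC : Integrable fun t => √(C t t))
    {x : Fin n → Cube d} (hG : (gram C x).PosDef)
    (hv : 0 < condVar (gram C x) (cVec C x) (c0 C)) (y : Fin n → ℝ) (z : ℝ) :
    jointDensity P f x y z = normalDensity (fun _ => m) (s2 • gram C x) y *
        gaussianPDFReal (m + cVec C x ⬝ᵥ (gram C x)⁻¹ *ᵥ (y - m • 1))
          (s2 * condVar (gram C x) (cVec C x) (c0 C)).toNNReal z := by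
  rw [jointDensity, IsContDensity.density_eq ⟨?_, fun p => mul_nonneg (normalDensity_nonneg _ _ _)
    (gaussianPDFReal_nonneg _ _ _), h.map_dataVec_integralOf hs hf hC hG hv⟩]
  have h1 : Continuous fun p : (Fin n → ℝ) × ℝ =>
      normalDensity (fun _ => m) (s2 • gram C x) p.1 :=
    (continuous_normalDensity _ _).comp continuous_fst
  have h2 : Continuous fun p : (Fin n → ℝ) × ℝ =>
      cVec C x ⬝ᵥ (gram C x)⁻¹ *ᵥ (p.1 - m • 1) :=
    Continuous.dotProduct continuous_const
      (Continuous.matrix_mulVec continuous_const (by fun_prop))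
  refine h1.mul ?_
  simp only [gaussianPDFReal]
  fun_prop

end IsGP

/-! ### Quadratic forms -/

section Quadratic

variable {n : ℕ} {A G : Matrix (Fin n) (Fin n) ℝ} {y : Fin n → ℝ}

theorem transpose_eq_of_posDef (hA : A.PosDef) : Aᵀ = A := by
  have := hA.isHermitian
  simpa [IsHermitian, conjTranspose_eq_transpose_of_trivial] using this

theorem dotProduct_mulVec_comm (hA : A.PosDef) (u w : Fin n → ℝ) :
    u ⬝ᵥ A *ᵥ w = w ⬝ᵥ A *ᵥ u := by
  rw [dotProduct_mulVec, ← mulVec_transpose, transpose_eq_of_posDef hA, dotProduct_comm]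

theorem quad_pos (hA : A.PosDef) {u : Fin n → ℝ} (hu : u ≠ 0) : 0 < u ⬝ᵥ A *ᵥ u := by
  simpa using hA.dotProduct_mulVec_pos hu

theorem one_ne_zero_of_nonconst (hy : ∃ i j, y i ≠ y j) : (1 : Fin n → ℝ) ≠ 0 := by
  obtain ⟨i, -, -⟩ := hy
  intro h
  simpa using congrFun h i

theorem two_le_of_nonconst (hy : ∃ i j, y i ≠ y j) : 2 ≤ n := by
  obtain ⟨i, j, hij⟩ := hy
  have h1 : (i : ℕ) ≠ j := fun h => hij (by rw [Fin.ext h])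
  omega

theorem projQuad_eq (hA : A.PosDef) (y : Fin n → ℝ) :
    projQuad A y = y ⬝ᵥ A *ᵥ y - (1 ⬝ᵥ A *ᵥ y) ^ 2 / (1 ⬝ᵥ A *ᵥ 1) := by
  rw [projQuad, sub_mulVec, smul_mulVec, ← mulVec_mulVec, ← mulVec_mulVec, dotProduct_sub,
    dotProduct_smul, vecMulVec_mulVec, smul_eq_mul]
  have : y ⬝ᵥ A *ᵥ (MulOpposite.op ((1 : Fin n → ℝ) ⬝ᵥ A *ᵥ y) • (1 : Fin n → ℝ)) =
      (1 ⬝ᵥ A *ᵥ y) ^ 2 := by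
    rw [op_smul_eq_smul, mulVec_smul, dotProduct_smul, dotProduct_mulVec_comm hA y, smul_eq_mul, sq]
  rw [this]
  ring

/-- Completing the square in `m`; the constant term is the minimum over `m`. With `A = 𝖢⁻¹` this
drives the likelihood, and with `A = 𝖢⁻²` it drives cross-validation. -/
theorem quad_sub_smul_one (hA : A.PosDef) (h1 : (1 : Fin n → ℝ) ≠ 0) (y : Fin n → ℝ) (m : ℝ) :
    (y - m • 1) ⬝ᵥ A *ᵥ (y - m • 1) = projQuad A y +
      (1 ⬝ᵥ A *ᵥ 1) * (m - (1 ⬝ᵥ A *ᵥ y) / (1 ⬝ᵥ A *ᵥ 1)) ^ 2 := by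
  have ha := quad_pos hA h1
  rw [projQuad_eq hA, mulVec_sub, mulVec_smul, dotProduct_sub, sub_dotProduct, sub_dotProduct,
    dotProduct_smul, smul_dotProduct, smul_dotProduct, dotProduct_smul,
    dotProduct_mulVec_comm hA y 1]
  simp only [smul_eq_mul]
  field_simp
  ring

/-- The projected form is the quadratic form at `y - m 𝟏` for the minimizing `m`, and this vector is
nonzero because `y` is not constant. -/
theorem projQuad_pos (hA : A.PosDef) (hy : ∃ i j, y i ≠ y j) : 0 < projQuad A y := by
  have h := quad_sub_smul_one hA (one_ne_zero_of_nonconst hy) y ((1 ⬝ᵥ A *ᵥ y) / (1 ⬝ᵥ A *ᵥ 1))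
  rw [sub_self, zero_pow two_ne_zero, mul_zero, add_zero] at h
  rw [← h]
  refine quad_pos hA fun h0 => ?_
  obtain ⟨i, j, hij⟩ := hy
  refine hij ?_
  have e := fun k => congrFun h0 k
  simp only [Pi.sub_apply, Pi.smul_apply, Pi.one_apply, smul_eq_mul, mul_one, Pi.zero_apply] at e
  linarith [e i, e j]

theorem posDef_sq (hA : A.PosDef) : (A ^ 2).PosDef := by
  have h := PosDef.conjTranspose_mul_self A
    (mulVec_injective_iff_isUnit.2 hA.isUnit)
  rwa [conjTranspose_eq_transpose_of_trivial, transpose_eq_of_posDef hA, ← sq] at h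

theorem sum_zeta_sq (hG : G.PosDef) (y : Fin n → ℝ) (m : ℝ) :
    ∑ i, zeta G y m i ^ 2 = (y - m • 1) ⬝ᵥ (G⁻¹ ^ 2) *ᵥ (y - m • 1) := by
  rw [sq, ← mulVec_mulVec, dotProduct_mulVec, ← mulVec_transpose, transpose_eq_of_posDef hG.inv]
  simp [zeta, dotProduct, sq]

theorem sum_zeta_sq_eq (hG : G.PosDef) (hy : ∃ i j, y i ≠ y j) (m : ℝ) :
    ∑ i, zeta G y m i ^ 2 = projQuad (G⁻¹ ^ 2) y +
      (1 ⬝ᵥ (G⁻¹ ^ 2) *ᵥ 1) * (m - mGCV G y) ^ 2 := by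
  rw [sum_zeta_sq hG, quad_sub_smul_one (posDef_sq hG.inv) (one_ne_zero_of_nonconst hy), mGCV]

/-- Completing the square in the replaced coordinate `z`. The precision is `A i i`, and the centre
and remainder do not depend on `z`, so the leave-one-out mean and variance can be read off. -/
theorem quad_update (hA : A.PosDef) (y : Fin n → ℝ) (m : ℝ) (i : Fin n) (z : ℝ) :
    (Function.update y i z - m • 1) ⬝ᵥ A *ᵥ (Function.update y i z - m • 1) =
      ((y - m • 1) ⬝ᵥ A *ᵥ (y - m • 1) - (A *ᵥ (y - m • 1)) i ^ 2 / A i i) +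
        A i i * (z - (y i - (A *ᵥ (y - m • 1)) i / A i i)) ^ 2 := by
  have hd : 0 < A i i := hA.diag_pos
  have hu : Function.update y i z - m • 1 = (y - m • 1) + (z - y i) • Pi.single i 1 := by
    funext k
    by_cases hk : k = i
    · subst hk; simp
    · simp [hk]
  have h1 : ∀ w : Fin n → ℝ, Pi.single i (1 : ℝ) ⬝ᵥ A *ᵥ w = (A *ᵥ w) i := fun w => by simp
  rw [hu, mulVec_add, mulVec_smul, dotProduct_add, add_dotProduct, add_dotProduct,
    dotProduct_smul, smul_dotProduct, smul_dotProduct, dotProduct_smul,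
    dotProduct_mulVec_comm hA (y - m • 1) (Pi.single i 1), h1, h1]
  have h2 : (A *ᵥ Pi.single i (1 : ℝ)) i = A i i := by simp
  rw [h2]
  simp only [smul_eq_mul]
  field_simp
  ring

end Quadratic

/-! ### The log-likelihood -/

section LogLikelihood

variable {n : ℕ} {G : Matrix (Fin n) (Fin n) ℝ} {y : Fin n → ℝ}

theorem inv_smul_posDef (hG : G.PosDef) {s2 : ℝ} (hs : 0 < s2) :
    (s2 • G)⁻¹ = s2⁻¹ • G⁻¹ := by
  refine inv_eq_right_inv ?_
  rw [smul_mul_smul_comm, mul_nonsing_inv _ hG.det_pos.ne'.isUnit, mul_inv_cancel₀ hs.ne',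
    one_smul]

theorem normalDensity_smul (hG : G.PosDef) {s2 : ℝ} (hs : 0 < s2) (m : ℝ) (y : Fin n → ℝ) :
    normalDensity (fun _ => m) (s2 • G) y = (√(2 * Real.pi))⁻¹ ^ n * (√G.det)⁻¹ * (√s2)⁻¹ ^ n *
      Real.exp (-((y - m • 1) ⬝ᵥ G⁻¹ *ᵥ (y - m • 1)) / (2 * s2)) := by
  have h1 : (fun _ => m : Fin n → ℝ) = m • 1 := by funext; simp
  have h2 : √(s2 • G).det = √s2 ^ n * √G.det := by
    have e : s2 ^ n = (√s2 ^ n) ^ 2 := by rw [← pow_mul, mul_comm, pow_mul, Real.sq_sqrt hs.le]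
    rw [det_smul, Fintype.card_fin, Real.sqrt_mul (by positivity), e, Real.sqrt_sq (by positivity)]
  rw [normalDensity, h1, h2, inv_smul_posDef hG hs, smul_mulVec, dotProduct_smul, smul_eq_mul,
    mul_inv, inv_pow (√s2)]
  have h3 : -(s2⁻¹ * ((y - m • 1) ⬝ᵥ G⁻¹ *ᵥ (y - m • 1))) / 2 =
      -((y - m • 1) ⬝ᵥ G⁻¹ *ᵥ (y - m • 1)) / (2 * s2) := by
    field_simp
  rw [h3]
  ring

theorem log_normalDensity_smul (hG : G.PosDef) (h1 : (1 : Fin n → ℝ) ≠ 0) {s2 : ℝ} (hs : 0 < s2)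
    (m : ℝ) (y : Fin n → ℝ) :
    Real.log (normalDensity (fun _ => m) (s2 • G) y) =
      -(n / 2 * Real.log (2 * Real.pi)) - Real.log G.det / 2 - n / 2 * Real.log s2 -
        (projQuad G⁻¹ y + (1 ⬝ᵥ G⁻¹ *ᵥ 1) * (m - mEB G y) ^ 2) / (2 * s2) := by
  have hd := Real.sqrt_pos.2 hG.det_pos
  have hs' := Real.sqrt_pos.2 hs
  rw [normalDensity_smul hG hs, quad_sub_smul_one hG.inv h1, Real.log_mul (by positivity)
    (Real.exp_pos _).ne', Real.log_mul (by positivity) (by positivity), Real.log_mul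
    (by positivity) (by positivity), Real.log_exp, Real.log_pow, Real.log_pow, Real.log_inv,
    Real.log_inv, Real.log_inv, Real.log_sqrt (by positivity), Real.log_sqrt hG.det_pos.le,
    Real.log_sqrt hs.le, mEB]
  ring

theorem isMaxOn_sub_sq_iff {g : ℝ → ℝ} {k b m₀ m : ℝ} (hb : 0 < b)
    (hg : ∀ m, g m = k - b * (m - m₀) ^ 2) : IsMaxOn g Set.univ m ↔ m = m₀ := by
  constructor
  · intro h
    have := h (Set.mem_univ m₀)
    simp only [Set.mem_ofPred_eq, hg, sub_self] at this
    have h2 : (m - m₀) ^ 2 ≤ 0 := by nlinarith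
    nlinarith [pow_eq_zero_iff (two_ne_zero) |>.1 (le_antisymm h2 (sq_nonneg _))]
  · rintro rfl m' -
    simp only [Set.mem_ofPred_eq, hg, sub_self]
    nlinarith [mul_nonneg hb.le (sq_nonneg (m' - m))]

theorem isMinOn_add_sq_iff {g : ℝ → ℝ} {k b m₀ m : ℝ} (hb : 0 < b)
    (hg : ∀ m, g m = k + b * (m - m₀) ^ 2) : IsMinOn g Set.univ m ↔ m = m₀ := by
  rw [← isMaxOn_sub_sq_iff (g := fun m => -g m) (k := -k) hb fun m => by rw [hg]; ring]
  exact ⟨fun h => h.neg, fun h => by simpa using h.neg⟩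

/-- With `r` the quotient of the claimed maximizer by `s`, the loss at `s` is `(N/2) (r - 1 - log
r)`, which is nonnegative and vanishes only at `r = 1`. -/
theorem isMaxOn_log_sub_inv_iff {g : ℝ → ℝ} {k N Q s : ℝ} (hN : 0 < N) (hQ : 0 < Q) (hs : 0 < s)
    (hg : ∀ s, 0 < s → g s = k - N / 2 * Real.log s - Q / (2 * s)) :
    IsMaxOn g (Set.Ioi 0) s ↔ s = 1 / N * Q := by
  have h0 : 0 < 1 / N * Q := by positivity
  have key : ∀ s, 0 < s → g (1 / N * Q) - g s =
      N / 2 * ((1 / N * Q / s - 1) - Real.log (1 / N * Q / s)) := fun s hs => by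
    rw [hg _ h0, hg _ hs, Real.log_div h0.ne' hs.ne']
    field_simp
    ring
  constructor
  · intro h
    by_contra hne
    have h1 : g (1 / N * Q) ≤ g s := h h0
    have h2 := Real.log_lt_sub_one_of_pos (div_pos h0 hs)
      fun h => hne ((div_eq_one_iff_eq hs.ne').1 h).symm
    have h3 := key s hs
    have : 0 < N / 2 * ((1 / N * Q / s - 1) - Real.log (1 / N * Q / s)) :=
      mul_pos (by positivity) (by linarith)
    linarith
  · rintro rfl t ht
    have h2 := Real.log_le_sub_one_of_pos (div_pos h0 ht)
    have h3 := key t ht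
    have : 0 ≤ N / 2 * ((1 / N * Q / t - 1) - Real.log (1 / N * Q / t)) :=
      mul_nonneg (by positivity) (by linarith)
    change g t ≤ g (1 / N * Q)
    linarith

theorem isMaxOn_iff_isMinOn_of_affine {Θ : Type*} {g h : Θ → ℝ} {k b : ℝ} (hb : 0 < b)
    (hg : ∀ θ, g θ = k - b * h θ) (θ : Θ) : IsMaxOn g Set.univ θ ↔ IsMinOn h Set.univ θ := by
  simp only [isMaxOn_iff, isMinOn_iff, hg, Set.mem_univ, true_implies]
  exact forall_congr' fun θ' => by
    rw [sub_le_sub_iff_left, mul_le_mul_iff_right₀ hb]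

/-- At the optimal scale the exponent `Q / (2 s²)` equals `n/2`, so only the logarithms of `Q` and
of the determinant vary with the kernel. -/
theorem log_normalDensity_profile (hG : G.PosDef) (hy : ∃ i j, y i ≠ y j) :
    Real.log (normalDensity (fun _ => mEB G y) (s2EB G y • G) y) =
      (-(n / 2 * Real.log (2 * Real.pi)) + n / 2 * Real.log n - n / 2) - n / 2 * objEB G y := by
  have hQ := projQuad_pos hG.inv hy
  have hn : (0 : ℝ) < n := by have := two_le_of_nonconst hy; positivity
  have hs : 0 < s2EB G y := by unfold s2EB; positivity
  rw [log_normalDensity_smul hG (one_ne_zero_of_nonconst hy) hs, objEB, s2EB,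
    Real.log_mul (by positivity) hQ.ne', one_div, Real.log_inv]
  field_simp
  ring

end LogLikelihood

/-! ### Generalized cross-validation -/

section CrossValidation

variable {n : ℕ} {G : Matrix (Fin n) (Fin n) ℝ} {y : Fin n → ℝ}

theorem trace_inv_pos (hG : G.PosDef) (hy : ∃ i j, y i ≠ y j) : 0 < G⁻¹.trace := by
  obtain ⟨i, -, -⟩ := hy
  have : Nonempty (Fin n) := ⟨i⟩
  exact hG.inv.trace_pos

theorem gcv_eq (hG : G.PosDef) (hy : ∃ i j, y i ≠ y j) (m : ℝ) :
    gcv G y m = (n / G⁻¹.trace) ^ 2 * projQuad (G⁻¹ ^ 2) y +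
      (n / G⁻¹.trace) ^ 2 * (1 ⬝ᵥ (G⁻¹ ^ 2) *ᵥ 1) * (m - mGCV G y) ^ 2 := by
  have hn : (n : ℝ) ≠ 0 := by have := two_le_of_nonconst hy; positivity
  have ht := (trace_inv_pos hG hy).ne'
  have : ∑ i, G⁻¹ i i = G⁻¹.trace := rfl
  rw [gcv, sum_zeta_sq_eq hG hy, this]
  field_simp

theorem log_gcv_mGCV (hG : G.PosDef) (hy : ∃ i j, y i ≠ y j) :
    0 < gcv G y (mGCV G y) ∧
    Real.log (gcv G y (mGCV G y)) = 2 * Real.log n + objGCV G y := by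
  have hn : (0 : ℝ) < n := by have := two_le_of_nonconst hy; positivity
  have ht := trace_inv_pos hG hy
  have hQ := projQuad_pos (posDef_sq hG.inv) hy
  have e : gcv G y (mGCV G y) = (n / G⁻¹.trace) ^ 2 * projQuad (G⁻¹ ^ 2) y := by
    rw [gcv_eq hG hy]; ring
  rw [e]
  refine ⟨by positivity, ?_⟩
  rw [Real.log_mul (by positivity) hQ.ne', Real.log_pow, Real.log_div hn.ne' ht.ne', objGCV]
  push_cast
  ring

theorem s2GCV_pos (hG : G.PosDef) (hy : ∃ i j, y i ≠ y j) : 0 < s2GCV G y :=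
  mul_pos (projQuad_pos (posDef_sq hG.inv) hy) (inv_pos.2 (trace_inv_pos hG hy))

theorem s2EB_pos (hG : G.PosDef) (hy : ∃ i j, y i ≠ y j) : 0 < s2EB G y := by
  have hQ := projQuad_pos hG.inv hy
  have hn : (0 : ℝ) < n := by have := two_le_of_nonconst hy; positivity
  unfold s2EB; positivity

theorem gcvScale_mGCV (hG : G.PosDef) (hy : ∃ i j, y i ≠ y j) :
    gcvScale G y (mGCV G y) = s2GCV G y := by
  have hn : (n : ℝ) ≠ 0 := by have := two_le_of_nonconst hy; positivity
  have : ∑ i, G⁻¹ i i = G⁻¹.trace := rfl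
  rw [gcvScale, sum_zeta_sq_eq hG hy, this, s2GCV, sub_self]
  have ht := (trace_inv_pos hG hy).ne'
  field_simp
  ring

end CrossValidation

/-! ### Normalization of Gaussian densities -/

theorem normalized_gaussian {k : ℝ} (hk : 0 < k) (μ : ℝ) {v : NNReal} (hv : v ≠ 0) :
    normalized (fun z => ENNReal.ofReal (k * gaussianPDFReal μ v z)) = gaussianReal μ v := by
  rw [normalized, gaussianReal_of_var_ne_zero _ hv]
  congr 1
  funext z
  simp_rw [ENNReal.ofReal_mul hk.le]
  rw [lintegral_const_mul _ (measurable_gaussianPDFReal μ v).ennreal_ofReal,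
    lintegral_gaussianPDFReal_eq_one _ hv, mul_one, mul_comm,
    ENNReal.mul_div_cancel_right (by simpa using hk) (by simp)]
  rfl

namespace IsGP

variable {d n : ℕ} {Ω : Type*} [MeasurableSpace Ω] {P : Measure Ω} {f : Cube d → Ω → ℝ}
  {m s2 : ℝ} {C : Cube d → Cube d → ℝ}

theorem leaveOneOut_eq (h : IsGP P f m fun t u => s2 * C t u) (hs : 0 < s2)
    (hf : Measurable (Function.uncurry f)) (hC : Integrable fun t => √(C t t))
    {x : Fin n → Cube d} (hG : (gram C x).PosDef) (y : Fin n → ℝ) (i : Fin n) :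
    leaveOneOut P f x y i = gaussianReal
      (y i - zeta (gram C x) y m i / (gram C x)⁻¹ i i) (s2 / (gram C x)⁻¹ i i).toNNReal := by
  have hd : 0 < (gram C x)⁻¹ i i := hG.inv.diag_pos
  have hv : 0 < s2 / (gram C x)⁻¹ i i := by positivity
  have hdet := Real.sqrt_pos.2 hG.det_pos
  have hs' := Real.sqrt_pos.2 hs
  set G := gram C x
  -- The constant `k` is what remains of the likelihood once the Gaussian factor in `z` is split
  -- off; the last square root compensates the normalizing factor of that Gaussian. Only its
  -- positivity matters.
  rw [leaveOneOut, ← normalized_gaussian (k := (√(2 * Real.pi))⁻¹ ^ n * (√G.det)⁻¹ *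
    (√s2)⁻¹ ^ n * Real.exp (-((y - m • 1) ⬝ᵥ G⁻¹ *ᵥ (y - m • 1) -
      (G⁻¹ *ᵥ (y - m • 1)) i ^ 2 / G⁻¹ i i) / (2 * s2)) * √(2 * Real.pi * (s2 / G⁻¹ i i)))
    (by positivity) _ (by simpa using hv)]
  congr 1
  funext z
  rw [h.likelihood_eq hs hf hC hG, normalDensity_smul hG hs, quad_update hG.inv, gaussianPDFReal,
    Real.coe_toNNReal _ hv.le, neg_add, add_div, Real.exp_add, zeta]
  congr 1
  have e : -(G⁻¹ i i * (z - (y i - (G⁻¹ *ᵥ (y - m • 1)) i / G⁻¹ i i)) ^ 2) / (2 * s2) =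
      -(z - (y i - (G⁻¹ *ᵥ (y - m • 1)) i / G⁻¹ i i)) ^ 2 / (2 * (s2 / G⁻¹ i i)) := by
    field_simp
  rw [e]
  have hq : √(2 * Real.pi * (s2 / G⁻¹ i i)) ≠ 0 := by positivity
  field_simp

theorem posterior_eq (h : IsGP P f m fun t u => s2 * C t u) (hs : 0 < s2)
    (hf : Measurable (Function.uncurry f)) (hC : Integrable fun t => √(C t t))
    {x : Fin n → Cube d} (hG : (gram C x).PosDef)
    (hv : 0 < condVar (gram C x) (cVec C x) (c0 C)) (y : Fin n → ℝ) :
    posterior P f x y = gaussianReal (m + cVec C x ⬝ᵥ (gram C x)⁻¹ *ᵥ (y - m • 1))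
      (s2 * condVar (gram C x) (cVec C x) (c0 C)).toNNReal := by
  rw [posterior, ← normalized_gaussian (normalDensity_pos (fun _ => m) (hG.smul hs) y) _
    (by simpa using mul_pos hs hv)]
  simp_rw [h.jointDensity_eq hs hf hC hG hv]

end IsGP

/-! ### Conditional mean of the integral at the estimated means -/

theorem condMean_mEB {n : ℕ} {G : Matrix (Fin n) (Fin n) ℝ} (hG : G.PosDef) (y c : Fin n → ℝ) :
    mEB G y + c ⬝ᵥ G⁻¹ *ᵥ (y - mEB G y • 1) = muEB G y c := by
  rw [muEB, mulVec_sub, mulVec_smul, dotProduct_sub, dotProduct_smul, add_dotProduct,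
    smul_dotProduct, dotProduct_mulVec_comm hG.inv 1 c, mEB]
  simp only [smul_eq_mul]
  ring

theorem condMean_mGCV {n : ℕ} {G : Matrix (Fin n) (Fin n) ℝ} (hG : G.PosDef) (y c : Fin n → ℝ) :
    mGCV G y + c ⬝ᵥ G⁻¹ *ᵥ (y - mGCV G y • 1) = muGCV G y c := by
  have : (G⁻¹ *ᵥ 1) ⬝ᵥ G⁻¹ *ᵥ y = 1 ⬝ᵥ (G⁻¹ ^ 2) *ᵥ y := by
    rw [sq, ← mulVec_mulVec, dotProduct_mulVec 1, ← mulVec_transpose,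
      transpose_eq_of_posDef hG.inv]
  rw [muGCV, mulVec_sub, mulVec_smul, dotProduct_sub, dotProduct_smul, add_dotProduct,
    smul_dotProduct, dotProduct_mulVec_comm hG.inv 1 c, this, mGCV]
  simp only [smul_eq_mul]
  ring

/-! ### Quantiles of symmetric distributions without atoms -/

section Quantile

variable {ν : Measure ℝ} [IsProbabilityMeasure ν]

theorem real_abs_le (hsymm : ν.map (fun t => -t) = ν) {q : ℝ} (hq : 0 ≤ q) :
    ν.real {t | |t| ≤ q} = 2 * cdf ν q - 1 := by
  have hneg : ν.real (Set.Iio (-q)) = 1 - cdf ν q := by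
    have h1 : ν.real (Set.Iio (-q)) = ν.real (Set.Ioi q) := by
      conv_lhs => rw [← hsymm]
      rw [map_measureReal_apply measurable_neg measurableSet_Iio]
      congr 1
      ext t
      simp
    rw [h1, ← Set.compl_Iic, probReal_compl_eq_one_sub measurableSet_Iic, cdf_eq_real]
  have hset : {t : ℝ | |t| ≤ q} = Set.Iic q \ Set.Iio (-q) := by
    ext t
    simp [abs_le, and_comm]
  rw [hset, measureReal_sdiff (Set.Iio_subset_Iic (by linarith))
    measurableSet_Iio, hneg, ← cdf_eq_real]
  ring

variable [NullSingletonClass ν]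

theorem continuous_cdf : Continuous (cdf ν) := by
  refine continuous_iff_continuousAt.2 fun t => ?_
  have h := (cdf ν).measure_singleton t
  rw [measure_cdf, measure_singleton, eq_comm, ENNReal.ofReal_eq_zero] at h
  rw [(monotone_cdf ν).continuousAt_iff_leftLim_eq_rightLim, (cdf ν).rightLim_eq]
  exact le_antisymm ((monotone_cdf ν).leftLim_le le_rfl) (by linarith)

/-- Without atoms the distribution function is continuous, so it takes the value `p`, and the
infimum defining the quantile is attained. -/
theorem cdf_quantile {p : ℝ} (h0 : 0 < p) (h1 : p < 1) : cdf ν (quantile ν p) = p := by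
  obtain ⟨a, ha⟩ := ((tendsto_cdf_atBot ν).eventually (gt_mem_nhds h0)).exists
  obtain ⟨b, hb⟩ := ((tendsto_cdf_atTop ν).eventually (lt_mem_nhds h1)).exists
  obtain ⟨t, ht⟩ := mem_range_of_exists_le_of_exists_ge (continuous_cdf (ν := ν))
    ⟨a, ha.le⟩ ⟨b, hb.le⟩
  have hbdd : BddBelow {t | p ≤ cdf ν t} :=
    ⟨a, fun s hs => le_of_not_gt fun hsa => absurd ((monotone_cdf ν) hsa.le)
      (not_le.2 (ha.trans_le hs))⟩
  refine le_antisymm ?_ ?_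
  · exact (monotone_cdf ν (csInf_le hbdd ht.ge)).trans_eq ht
  · exact (isClosed_le continuous_const continuous_cdf).csInf_mem ⟨t, ht.ge⟩ hbdd

theorem cdf_zero (hsymm : ν.map (fun t => -t) = ν) : cdf ν 0 = 1 / 2 := by
  have h := real_abs_le hsymm le_rfl
  have : {t : ℝ | |t| ≤ 0} = {0} := by ext t; simp
  rw [this, measureReal_def, measure_singleton] at h
  simp at h
  linarith

theorem quantile_pos (hsymm : ν.map (fun t => -t) = ν) {p : ℝ} (h0 : 1 / 2 < p) (h1 : p < 1) :
    0 < quantile ν p := by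
  by_contra hq
  have := monotone_cdf ν (not_lt.1 hq)
  rw [cdf_zero hsymm, cdf_quantile (by linarith) h1] at this
  linarith

theorem real_abs_le_quantile (hsymm : ν.map (fun t => -t) = ν) :
    ν.real {t | |t| ≤ quantile ν 0.995} = 0.99 := by
  rw [real_abs_le hsymm (quantile_pos hsymm (by norm_num) (by norm_num)).le,
    cdf_quantile (by norm_num) (by norm_num)]
  norm_num

theorem lt_quantile_of_real_abs_le_lt (hsymm : ν.map (fun t => -t) = ν) {q : ℝ}
    (h : ν.real {t | |t| ≤ q} < 0.99) : q < quantile ν 0.995 := by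
  by_contra hq
  have := measureReal_mono (μ := ν) (s₁ := {t : ℝ | |t| ≤ quantile ν 0.995}) (s₂ := {t | |t| ≤ q})
    fun t (ht : |t| ≤ _) => ht.trans (not_lt.1 hq)
  rw [real_abs_le_quantile hsymm] at this
  linarith

theorem quantile_lt_of_lt_real_abs_le (hsymm : ν.map (fun t => -t) = ν) {q : ℝ}
    (h : 0.99 < ν.real {t | |t| ≤ q}) : quantile ν 0.995 < q := by
  by_contra hq
  have := measureReal_mono (μ := ν) (s₂ := {t : ℝ | |t| ≤ quantile ν 0.995}) (s₁ := {t | |t| ≤ q})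
    fun t (ht : |t| ≤ _) => ht.trans (not_lt.1 hq)
  rw [real_abs_le_quantile hsymm] at this
  linarith

end Quantile

/-! ### Affine changes of variable on the line -/

theorem real_abs_sub_le {post : Measure ℝ} (μ : ℝ) {σ : ℝ} (hσ : 0 < σ) (q : ℝ) :
    post.real {z | |z - μ| ≤ q * σ} =
      (post.map fun z => (z - μ) / σ).real {t | |t| ≤ q} := by
  rw [map_measureReal_apply (by fun_prop) (measurableSet_le (by fun_prop) (by fun_prop))]
  congr 1
  ext z
  simp only [Set.mem_ofPred_eq, Set.preimage_ofPred_eq, abs_div, abs_of_pos hσ, div_le_iff₀ hσ]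

/-- The affine bijection `t ↦ σ t + μ` of the line. -/
def affineEquiv (μ : ℝ) {σ : ℝ} (hσ : 0 < σ) : ℝ ≃ᵐ ℝ where
  toFun t := σ * t + μ
  invFun z := (z - μ) / σ
  left_inv t := by field_simp; ring
  right_inv z := by field_simp; ring
  measurable_toFun := by
    change Measurable fun t => σ * t + μ
    fun_prop
  measurable_invFun := by
    change Measurable fun z => (z - μ) / σ
    fun_prop

theorem map_affineEquiv_withDensity (μ : ℝ) {σ : ℝ} (hσ : 0 < σ) (g : ℝ → ℝ) :
    (volume.withDensity fun t => ENNReal.ofReal (g t)).map (affineEquiv μ hσ) =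
      volume.withDensity fun z => ENNReal.ofReal (σ⁻¹ * g ((z - μ) / σ)) := by
  have hvol : (volume : Measure ℝ).map (affineEquiv μ hσ) = ENNReal.ofReal σ⁻¹ • volume := by
    have h1 : (affineEquiv μ hσ : ℝ → ℝ) = (fun t => t + μ) ∘ fun t => σ * t := rfl
    rw [h1, ← Measure.map_map (by fun_prop) (by fun_prop), Real.map_volume_mul_left hσ.ne',
      Measure.map_smul, (measurePreserving_add_right volume μ).map_eq,
      abs_of_pos (inv_pos.2 hσ)]
  rw [map_withDensity_equiv, hvol, withDensity_smul_measure, ← withDensity_smul' _ _ (by simp)]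
  congr 1
  funext z
  rw [Pi.smul_apply, smul_eq_mul, ENNReal.ofReal_mul (inv_nonneg.2 hσ.le)]
  rfl

theorem normalized_const_mul {k : ℝ≥0∞} (hk0 : k ≠ 0) (hk : k ≠ ∞) {q : ℝ → ℝ≥0∞}
    (hq : Measurable q) (h1 : ∫⁻ z, q z = 1) :
    normalized (fun z => k * q z) = volume.withDensity q := by
  rw [normalized]
  congr 1
  funext z
  rw [lintegral_const_mul _ hq, h1, mul_one, mul_comm, ENNReal.mul_div_cancel_right hk0 hk]

/-! ### Student's distribution -/

theorem lintegral_Ioi_rpow_mul_exp {a r : ℝ} (ha : 0 < a) (hr : 0 < r) :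
    ∫⁻ t in Set.Ioi (0 : ℝ), ENNReal.ofReal (t ^ (a - 1) * Real.exp (-(r * t))) =
      ENNReal.ofReal ((1 / r) ^ a * Real.Gamma a) := by
  have h := Real.integral_rpow_mul_exp_neg_mul_Ioi ha hr
  have hpos : 0 < (1 / r) ^ a * Real.Gamma a :=
    mul_pos (by positivity) (Real.Gamma_pos_of_pos ha)
  rw [← h, ofReal_integral_eq_lintegral_ofReal
    (Integrable.of_integral_ne_zero (by rw [h]; exact hpos.ne'))]
  filter_upwards [self_mem_ae_restrict measurableSet_Ioi] with t ht
  have : 0 < t := ht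
  positivity

theorem lintegral_exp_neg_mul_sq {b : ℝ} (hb : 0 < b) (u : ℝ) :
    ∫⁻ t, ENNReal.ofReal (Real.exp (-b * (t - u) ^ 2)) = ENNReal.ofReal √(Real.pi / b) := by
  rw [lintegral_sub_right_eq_self (fun t => ENNReal.ofReal (Real.exp (-b * t ^ 2))) u,
    ← integral_gaussian, ofReal_integral_eq_lintegral_ofReal (integrable_exp_neg_mul_sq hb)
      (ae_of_all _ fun t => (Real.exp_pos _).le)]

/-- The density of Student's `t`-distribution. -/
def studentPDF (ν t : ℝ) : ℝ :=
  Real.Gamma ((ν + 1) / 2) / (Real.sqrt (ν * Real.pi) * Real.Gamma (ν / 2)) *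
      (1 + t ^ 2 / ν) ^ (-((ν + 1) / 2))

theorem studentT_eq (ν : ℝ) :
    studentT ν = volume.withDensity fun t => ENNReal.ofReal (studentPDF ν t) := rfl

section Student

variable {ν : ℝ}

theorem studentPDF_const_pos (hν : 0 < ν) :
    0 < Real.Gamma ((ν + 1) / 2) / (Real.sqrt (ν * Real.pi) * Real.Gamma (ν / 2)) := by
  have h1 := Real.Gamma_pos_of_pos (by linarith : 0 < (ν + 1) / 2)
  have h2 := Real.Gamma_pos_of_pos (by linarith : 0 < ν / 2)
  positivity

theorem studentPDF_pos (hν : 0 < ν) (t : ℝ) : 0 < studentPDF ν t :=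
  mul_pos (studentPDF_const_pos hν) (by positivity)

theorem continuous_studentPDF (hν : 0 < ν) : Continuous (studentPDF ν) := by
  unfold studentPDF
  refine continuous_const.mul (Continuous.rpow_const (by fun_prop) fun t => Or.inl ?_)
  positivity

theorem studentPDF_neg (t : ℝ) : studentPDF ν (-t) = studentPDF ν t := by
  simp [studentPDF]

/-- The power of `1 + t²/ν` is written as a Gamma integral over a rate `l`. After exchanging the
integrals, the one in `t` is Gaussian and contributes `√(νπ/l)`, which leaves the Gamma integral for
`ν/2`. -/
theorem lintegral_studentPDF (hν : 0 < ν) : ∫⁻ t, ENNReal.ofReal (studentPDF ν t) = 1 := by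
  have h1 := Real.Gamma_pos_of_pos (by linarith : 0 < (ν + 1) / 2)
  have h2 := Real.Gamma_pos_of_pos (by linarith : 0 < ν / 2)
  have hk : ∀ t, ENNReal.ofReal (studentPDF ν t) =
      ENNReal.ofReal (√(ν * Real.pi) * Real.Gamma (ν / 2))⁻¹ *
        ∫⁻ l in Set.Ioi (0 : ℝ), ENNReal.ofReal
          (l ^ ((ν + 1) / 2 - 1) * Real.exp (-((1 + t ^ 2 / ν) * l))) := fun t => by
    have hp : 0 < 1 + t ^ 2 / ν := by positivity
    rw [lintegral_Ioi_rpow_mul_exp (by linarith) hp, ← ENNReal.ofReal_mul (by positivity),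
      one_div, Real.inv_rpow hp.le, ← Real.rpow_neg hp.le, studentPDF]
    congr 1
    field_simp
  simp_rw [hk]
  have hm : Measurable (Function.uncurry fun t l : ℝ => ENNReal.ofReal
      (l ^ ((ν + 1) / 2 - 1) * Real.exp (-((1 + t ^ 2 / ν) * l)))) := by
    simp only [Function.uncurry_def]
    fun_prop
  rw [lintegral_const_mul _ hm.lintegral_prod_right, lintegral_lintegral_swap hm.aemeasurable]
  have hin : ∀ l ∈ Set.Ioi (0 : ℝ), ∫⁻ t : ℝ, ENNReal.ofReal
      (l ^ ((ν + 1) / 2 - 1) * Real.exp (-((1 + t ^ 2 / ν) * l))) =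
      ENNReal.ofReal √(ν * Real.pi) *
        ENNReal.ofReal (l ^ (ν / 2 - 1) * Real.exp (-(1 * l))) := fun l hl => by
    have hl : 0 < l := hl
    have e : ∀ t : ℝ, ENNReal.ofReal
        (l ^ ((ν + 1) / 2 - 1) * Real.exp (-((1 + t ^ 2 / ν) * l))) =
        ENNReal.ofReal (l ^ ((ν + 1) / 2 - 1) * Real.exp (-(1 * l))) *
          ENNReal.ofReal (Real.exp (-(l / ν) * (t - 0) ^ 2)) := fun t => by
      rw [← ENNReal.ofReal_mul (by positivity), mul_assoc, ← Real.exp_add]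
      congr 3
      ring
    simp_rw [e]
    rw [lintegral_const_mul _ (by fun_prop), lintegral_exp_neg_mul_sq (by positivity),
      ← ENNReal.ofReal_mul (by positivity), ← ENNReal.ofReal_mul (by positivity)]
    congr 1
    have e1 : Real.pi / (l / ν) = ν * Real.pi / l := by field_simp
    have e2 : (ν + 1) / 2 - 1 = (ν / 2 - 1) + 1 / 2 := by ring
    rw [e1, Real.sqrt_div (by positivity), e2, Real.rpow_add hl, ← Real.sqrt_eq_rpow]
    have : √l ≠ 0 := by positivity
    field_simp
  rw [setLIntegral_congr_fun measurableSet_Ioi hin, lintegral_const_mul _ (by fun_prop),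
    lintegral_Ioi_rpow_mul_exp (by linarith) one_pos, ← ENNReal.ofReal_mul (by positivity),
    ← ENNReal.ofReal_mul (by positivity)]
  rw [div_one, Real.one_rpow, one_mul, inv_mul_cancel₀ (by positivity), ENNReal.ofReal_one]

theorem isProbabilityMeasure_studentT (hν : 0 < ν) : IsProbabilityMeasure (studentT ν) :=
  ⟨by rw [studentT_eq, withDensity_apply _ MeasurableSet.univ, Measure.restrict_univ,
    lintegral_studentPDF hν]⟩

theorem nullSingletonClass_studentT : NullSingletonClass (studentT ν) :=
  ⟨fun t => withDensity_absolutelyContinuous _ _ (by simp)⟩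

theorem studentT_map_neg : (studentT ν).map (fun t => -t) = studentT ν := by
  have h := map_withDensity_equiv (MeasurableEquiv.neg ℝ) (volume : Measure ℝ)
    (g := fun t => ENNReal.ofReal (studentPDF ν t))
  have hv : (volume : Measure ℝ).map (MeasurableEquiv.neg ℝ) = volume :=
    (Measure.measurePreserving_neg volume).map_eq
  rw [hv] at h
  rw [studentT_eq]
  refine h.trans ?_
  congr 1
  funext t
  exact congrArg ENNReal.ofReal (studentPDF_neg t)

/-- Since `|t| ≤ √ν √(1 + t²/ν)`, the first moment is dominated by a multiple of `(1 +
t²/ν)^(-ν/2)`, which is integrable exactly because `ν > 1`. -/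
theorem integrable_id_studentT (hν : 1 < ν) : Integrable id (studentT ν) := by
  have hν0 : 0 < ν := by linarith
  have hc := studentPDF_const_pos hν0
  have hm : Measurable fun t => ENNReal.ofReal (studentPDF ν t) :=
    (continuous_studentPDF hν0).measurable.ennreal_ofReal
  rw [studentT_eq, integrable_withDensity_iff_integrable_smul' hm (ae_of_all _ fun t => by simp)]
  have hi : Integrable fun t : ℝ => (1 + t ^ 2 / ν) ^ (-ν / 2) := by
    have h := (integrable_rpow_neg_one_add_norm_sq (E := ℝ) (μ := volume) (r := ν)
      (by simpa using hν)).comp_mul_left' (R := (√ν)⁻¹) (by positivity)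
    refine h.congr (ae_of_all _ fun t => ?_)
    simp only [Real.norm_eq_abs, sq_abs, mul_pow, inv_pow, Real.sq_sqrt hν0.le]
    congr 2
    ring
  refine (hi.const_mul (Real.Gamma ((ν + 1) / 2) / (√(ν * Real.pi) * Real.Gamma (ν / 2)) *
    √ν)).mono' ?_ (ae_of_all _ fun t => ?_)
  · have := continuous_studentPDF hν0
    exact Measurable.aestronglyMeasurable (by fun_prop)
  · have hp : 0 < 1 + t ^ 2 / ν := by positivity
    rw [ENNReal.toReal_ofReal (studentPDF_pos hν0 t).le, smul_eq_mul, norm_mul,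
      Real.norm_of_nonneg (studentPDF_pos hν0 t).le, studentPDF, id, Real.norm_eq_abs]
    have e : (1 + t ^ 2 / ν) ^ (-((ν + 1) / 2)) =
        (1 + t ^ 2 / ν) ^ (-ν / 2) * (√(1 + t ^ 2 / ν))⁻¹ := by
      rw [Real.sqrt_eq_rpow, ← Real.rpow_neg hp.le, ← Real.rpow_add hp]
      congr 1
      ring
    have hs : |t| ≤ √ν * √(1 + t ^ 2 / ν) := by
      rw [← Real.sqrt_mul hν0.le]
      refine Real.abs_le_sqrt ?_
      rw [mul_add, mul_div_cancel₀ _ hν0.ne']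
      linarith
    have hs0 : 0 < √(1 + t ^ 2 / ν) := Real.sqrt_pos.2 hp
    rw [e]
    have hA : 0 ≤ (1 + t ^ 2 / ν) ^ (-ν / 2) := by positivity
    have hs2 : (√(1 + t ^ 2 / ν))⁻¹ * |t| ≤ √ν := by
      rw [inv_mul_le_iff₀ hs0, mul_comm]; exact hs
    calc _ = Real.Gamma ((ν + 1) / 2) / (√(ν * Real.pi) * Real.Gamma (ν / 2)) *
          (1 + t ^ 2 / ν) ^ (-ν / 2) * ((√(1 + t ^ 2 / ν))⁻¹ * |t|) := by ring
      _ ≤ Real.Gamma ((ν + 1) / 2) / (√(ν * Real.pi) * Real.Gamma (ν / 2)) *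
          (1 + t ^ 2 / ν) ^ (-ν / 2) * √ν := by gcongr
      _ = _ := by ring

theorem integral_id_studentT : ∫ t, t ∂(studentT ν) = 0 := by
  have h : ∫ t, t ∂(studentT ν) = ∫ t, -t ∂(studentT ν) := by
    conv_lhs => rw [← studentT_map_neg]
    rw [integral_map (by fun_prop) (by fun_prop)]
  rw [integral_neg] at h
  linarith

end Student

/-! ### Numerical values of the normal distribution -/

theorem hasDerivAt_sum_neg_pow (N : ℕ) (u : ℝ) :
    HasDerivAt (fun u : ℝ => ∑ k ∈ Finset.range (N + 1), (-u) ^ k / k.factorial)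
      (-∑ k ∈ Finset.range N, (-u) ^ k / k.factorial) u := by
  induction N with
  | zero => simpa using hasDerivAt_const u (1 : ℝ)
  | succ N ih =>
    simp_rw [Finset.sum_range_succ _ (N + 1)]
    rw [Finset.sum_range_succ _ N, neg_add]
    refine ih.add ?_
    refine (((hasDerivAt_neg u).fun_pow (N + 1)).div_const ((N + 1).factorial : ℝ)).congr_deriv ?_
    have : ((N + 1).factorial : ℝ) = (N + 1) * N.factorial := by
      rw [Nat.factorial_succ]; push_cast; ring
    rw [this]
    have h0 : (N.factorial : ℝ) ≠ 0 := by positivity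
    have h1 : (N : ℝ) + 1 ≠ 0 := by positivity
    rw [Nat.add_sub_cancel]
    push_cast
    field_simp

/-- The Taylor polynomials of `exp (-u)` alternately bound it from above and below on `[0, ∞)`. -/
theorem alternating_exp_neg (N : ℕ) {u : ℝ} (hu : 0 ≤ u) :
    0 ≤ (-1) ^ N * (Real.exp (-u) - ∑ k ∈ Finset.range N, (-u) ^ k / k.factorial) := by
  induction N generalizing u with
  | zero => simpa using (Real.exp_pos _).le
  | succ N ih =>
    set g : ℝ → ℝ := fun u => (-1) ^ (N + 1) *
      (Real.exp (-u) - ∑ k ∈ Finset.range (N + 1), (-u) ^ k / k.factorial) with hg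
    have hd : ∀ u, HasDerivAt g ((-1) ^ N *
        (Real.exp (-u) - ∑ k ∈ Finset.range N, (-u) ^ k / k.factorial)) u := fun u => by
      have h1 : HasDerivAt (fun u : ℝ => Real.exp (-u)) (-Real.exp (-u)) u := by
        simpa using (hasDerivAt_id u).neg.exp
      refine ((h1.fun_sub (hasDerivAt_sum_neg_pow N u)).const_mul
        ((-1 : ℝ) ^ (N + 1))).congr_deriv ?_
      ring
    have hmono : MonotoneOn g (Set.Ici 0) :=
      monotoneOn_of_deriv_nonneg (convex_Ici 0) (fun u _ => (hd u).continuousAt.continuousWithinAt)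
        (fun u _ => (hd u).differentiableAt.differentiableWithinAt) fun u hu' => by
          rw [(hd u).deriv]
          rw [interior_Ici] at hu'
          exact ih hu'.le
    have h0 : g 0 = 0 := by
      simp [hg, Finset.sum_range_succ']
    have := hmono (Set.self_mem_Ici) (Set.mem_Ici.2 hu) hu
    rwa [h0] at this

theorem integral_taylor (N : ℕ) (q : ℝ) :
    ∫ t in (-q)..q, ∑ k ∈ Finset.range N, (-(t ^ 2 / 2)) ^ k / (k.factorial : ℝ) =
      ∑ k ∈ Finset.range N, (-1) ^ k / (2 ^ k * k.factorial) *
        (2 * q ^ (2 * k + 1) / (2 * k + 1)) := by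
  rw [intervalIntegral.integral_finsetSum fun k _ => Continuous.intervalIntegrable (by fun_prop) _ _]
  refine Finset.sum_congr rfl fun k _ => ?_
  have : ∀ t : ℝ, (-(t ^ 2 / 2)) ^ k / (k.factorial : ℝ) =
      (-1) ^ k / (2 ^ k * k.factorial) * t ^ (2 * k) := fun t => by
    rw [neg_pow, div_pow, ← pow_mul]
    field_simp
  simp_rw [this]
  rw [intervalIntegral.integral_const_mul, integral_pow, Odd.neg_pow ⟨k, rfl⟩]
  push_cast
  ring

theorem gaussianReal_real_abs_le {q : ℝ} (hq : 0 ≤ q) :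
    (gaussianReal 0 1).real {t | |t| ≤ q} =
      (√(2 * Real.pi))⁻¹ * ∫ t in (-q)..q, Real.exp (-(t ^ 2 / 2)) := by
  have hset : {t : ℝ | |t| ≤ q} = Set.Icc (-q) q := by ext t; simp [abs_le]
  rw [measureReal_def, gaussianReal_apply_eq_integral _ one_ne_zero, hset, ENNReal.toReal_ofReal
    (integral_nonneg fun t => gaussianPDFReal_nonneg _ _ _), integral_Icc_eq_integral_Ioc,
    ← intervalIntegral.integral_of_le (by linarith), ← intervalIntegral.integral_const_mul]
  refine intervalIntegral.integral_congr fun t _ => ?_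
  simp [gaussianPDFReal, neg_div]

/-- An odd number of Taylor terms bounds `exp (-u)` from above on `[0, ∞)`, an even number from
below. About twenty terms separate the values needed at 2.575 and 2.58. -/
theorem integral_exp_le {q : ℝ} (hq : 0 ≤ q) :
    ∫ t in (-q)..q, Real.exp (-(t ^ 2 / 2)) ≤ ∑ k ∈ Finset.range 21,
      (-1) ^ k / (2 ^ k * k.factorial) * (2 * q ^ (2 * k + 1) / (2 * k + 1)) := by
  rw [← integral_taylor]
  refine intervalIntegral.integral_mono_on (by linarith)
    (Continuous.intervalIntegrable (by fun_prop) _ _)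
    (Continuous.intervalIntegrable (by fun_prop) _ _) fun t _ => ?_
  have := alternating_exp_neg 21 (by positivity : 0 ≤ t ^ 2 / 2)
  rw [Odd.neg_one_pow (by decide : Odd 21)] at this
  linarith

theorem le_integral_exp {q : ℝ} (hq : 0 ≤ q) :
    ∑ k ∈ Finset.range 20, (-1) ^ k / (2 ^ k * k.factorial) *
      (2 * q ^ (2 * k + 1) / (2 * k + 1)) ≤ ∫ t in (-q)..q, Real.exp (-(t ^ 2 / 2)) := by
  rw [← integral_taylor]
  refine intervalIntegral.integral_mono_on (by linarith)
    (Continuous.intervalIntegrable (by fun_prop) _ _)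
    (Continuous.intervalIntegrable (by fun_prop) _ _) fun t _ => ?_
  have := alternating_exp_neg 20 (by positivity : 0 ≤ t ^ 2 / 2)
  rw [Even.neg_one_pow (by decide : Even 20)] at this
  linarith

/-- Squaring removes `√(2π)` and leaves a rational inequality, given decimal bounds for `π`. -/
theorem gaussianReal_lt_of_lt {q U p : ℝ} (hq : 0 ≤ q) (hp : 0 < p)
    (hU : ∫ t in (-q)..q, Real.exp (-(t ^ 2 / 2)) ≤ U)
    (h : U ^ 2 < p ^ 2 * (2 * 3.141592)) : (gaussianReal 0 1).real {t | |t| ≤ q} < p := by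
  rw [gaussianReal_real_abs_le hq, inv_mul_lt_iff₀ (by positivity)]
  refine hU.trans_lt (lt_of_pow_lt_pow_left₀ 2 (by positivity) (h.trans ?_))
  rw [mul_pow, Real.sq_sqrt (by positivity)]
  nlinarith [Real.pi_gt_d6, pow_pos hp 2]

theorem lt_gaussianReal_of_lt {q U p : ℝ} (hq : 0 ≤ q) (hU0 : 0 ≤ U)
    (hU : U ≤ ∫ t in (-q)..q, Real.exp (-(t ^ 2 / 2)))
    (h : p ^ 2 * (2 * 3.141593) < U ^ 2) : p < (gaussianReal 0 1).real {t | |t| ≤ q} := by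
  rw [gaussianReal_real_abs_le hq, lt_inv_mul_iff₀ (by positivity)]
  refine (lt_of_pow_lt_pow_left₀ 2 hU0 (lt_of_lt_of_le' h ?_)).trans_le hU
  rw [mul_pow, Real.sq_sqrt (by positivity)]
  nlinarith [Real.pi_lt_d6, sq_nonneg p]

theorem gaussianReal_abs_le_lower : (gaussianReal 0 1).real {t | |t| ≤ 2.575} < 0.99 := by
  refine gaussianReal_lt_of_lt (by norm_num) (by norm_num) (integral_exp_le (by norm_num)) ?_
  norm_num [Finset.sum_range_succ, Nat.factorial]

theorem gaussianReal_abs_le_rounded_gt : 0.99 < (gaussianReal 0 1).real {t | |t| ≤ 2.58} := by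
  refine lt_gaussianReal_of_lt (by norm_num) ?_ (le_integral_exp (by norm_num)) ?_
  · norm_num [Finset.sum_range_succ, Nat.factorial]
  · norm_num [Finset.sum_range_succ, Nat.factorial]

theorem gaussianReal_abs_le_rounded_lt : (gaussianReal 0 1).real {t | |t| ≤ 2.58} < 0.9905 := by
  refine gaussianReal_lt_of_lt (by norm_num) (by norm_num) (integral_exp_le (by norm_num)) ?_
  norm_num [Finset.sum_range_succ, Nat.factorial]

theorem gaussianReal_map_neg_std : (gaussianReal 0 1).map (fun t => -t) = gaussianReal 0 1 := by
  rw [gaussianReal_map_neg, neg_zero]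

theorem zQ_bounds : 2.575 < zQ ∧ zQ < 2.58 := by
  have := nullSingletonClass_gaussianReal (μ := 0) (one_ne_zero (α := NNReal))
  exact ⟨lt_quantile_of_real_abs_le_lt gaussianReal_map_neg_std gaussianReal_abs_le_lower,
    quantile_lt_of_lt_real_abs_le gaussianReal_map_neg_std gaussianReal_abs_le_rounded_gt⟩

theorem gaussianReal_abs_le_zQ : (gaussianReal 0 1).real {t | |t| ≤ zQ} = 0.99 := by
  have := nullSingletonClass_gaussianReal (μ := 0) (one_ne_zero (α := NNReal))
  exact real_abs_le_quantile gaussianReal_map_neg_std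

theorem gaussianReal_map_standardize (μ : ℝ) {v : ℝ} (hv : 0 < v) :
    (gaussianReal μ v.toNNReal).map (fun z => (z - μ) / √v) = gaussianReal 0 1 := by
  have h : (fun z => (z - μ) / √v) = (fun z => z / √v) ∘ fun z => z - μ := rfl
  rw [h, ← Measure.map_map (by fun_prop) (by fun_prop), gaussianReal_map_sub_const,
    gaussianReal_map_div_const, sub_self, zero_div]
  congr 1
  ext
  simp only [NNReal.coe_div, Real.coe_toNNReal _ hv.le, NNReal.coe_mk, Real.sq_sqrt hv.le,
    div_self hv.ne', NNReal.coe_one]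

/-! ### Comparison of the normal and Student's distribution -/

/-- If the ratio `h / g` of two probability densities increases with `|t|`, then `h` gives smaller
mass to symmetric intervals. -/
theorem integral_symm_lt {g h : ℝ → ℝ} (hgc : Continuous g) (hhc : Continuous h)
    (hg0 : ∀ t, 0 < g t) (hgi : Integrable g) (hhi : Integrable h) (hg1 : ∫ t, g t = 1)
    (hh1 : ∫ t, h t = 1) {q : ℝ} (hq : 0 < q)
    (hin : ∀ t, |t| < q → h t * g q < h q * g t) (hout : ∀ t, q ≤ |t| → h q * g t ≤ h t * g q)
    (hlt : ∫ t in (-q)..q, g t < 1) : ∫ t in (-q)..q, h t < ∫ t in (-q)..q, g t := by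
  have hqq : -q ≤ q := by linarith
  have hsplit : ∀ {u : ℝ → ℝ}, Integrable u → ∫ t, u t = 1 →
      ∫ t in (Set.Ioc (-q) q)ᶜ, u t = 1 - ∫ t in (-q)..q, u t := fun {u} hu hu1 => by
    rw [intervalIntegral.integral_of_le hqq, ← hu1,
      ← integral_add_compl (measurableSet_Ioc (a := -q) (b := q)) hu]
    ring
  have h1 : ∫ t in (-q)..q, h t * g q < ∫ t in (-q)..q, h q * g t := by
    refine intervalIntegral.integral_lt_integral_of_continuousOn_of_le_of_exists_lt (by linarith)
      (by fun_prop) (by fun_prop) (fun t ht => ?_) ⟨0, ⟨by linarith, hq.le⟩, hin 0 (by simpa)⟩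
    rcases eq_or_lt_of_le ht.2 with rfl | hlt
    · exact le_rfl
    · exact (hin t (abs_lt.2 ⟨ht.1, hlt⟩)).le
  have h2 : ∫ t in (Set.Ioc (-q) q)ᶜ, h q * g t ≤ ∫ t in (Set.Ioc (-q) q)ᶜ, h t * g q := by
    refine setIntegral_mono_on (hgi.const_mul _).integrableOn (hhi.mul_const _).integrableOn
      measurableSet_Ioc.compl fun t ht => hout t ?_
    by_contra hc
    exact ht ⟨(abs_lt.1 (not_le.1 hc)).1, (abs_lt.1 (not_le.1 hc)).2.le⟩
  rw [intervalIntegral.integral_mul_const, intervalIntegral.integral_const_mul] at h1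
  rw [integral_const_mul, integral_mul_const, hsplit hgi hg1, hsplit hhi hh1] at h2
  set A := ∫ t in (-q)..q, g t
  set B := ∫ t in (-q)..q, h t
  have hA0 : 0 ≤ A := intervalIntegral.integral_nonneg hqq fun t _ => (hg0 t).le
  have hgq := hg0 q
  -- Inside, `B g(q) < h(q) A`; outside, `h(q) (1 - A) ≤ (1 - B) g(q)`. Eliminating `h(q)` gives `B
  -- (1 - A) < A (1 - B)` up to the factor `g(q)`, that is `B < A`.
  have h3 : B * g q * (1 - A) < h q * A * (1 - A) :=
    mul_lt_mul_of_pos_right h1 (by linarith)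
  have h4 : A * (h q * (1 - A)) ≤ A * ((1 - B) * g q) := mul_le_mul_of_nonneg_left h2 hA0
  have h5 : (B - A) * g q < 0 := by nlinarith
  nlinarith

/-- After taking logarithms: `log (1 + w/N)` grows more slowly than `w/N`. Hence the Student kernel
decays more slowly than the normal one. -/
theorem rpow_mul_exp_lt {N u w : ℝ} (hN : 0 < N) (hu : 0 ≤ u) (huw : u < w) :
    (1 + u / N) ^ (-(N / 2)) * Real.exp (-w / 2) < (1 + w / N) ^ (-(N / 2)) * Real.exp (-u / 2) := by
  have hw : 0 < w := hu.trans_lt huw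
  have h1 : 0 < 1 + u / N := by positivity
  have h2 : 0 < 1 + w / N := by positivity
  rw [Real.rpow_def_of_pos h1, Real.rpow_def_of_pos h2, ← Real.exp_add, ← Real.exp_add,
    Real.exp_lt_exp]
  have h3 : 0 < (1 + w / N) / (1 + u / N) := by positivity
  have hne : (1 + w / N) / (1 + u / N) ≠ 1 := by
    rw [Ne, div_eq_one_iff_eq h1.ne']
    intro h
    have : w / N = u / N := by linarith
    rw [div_left_inj' hN.ne'] at this
    linarith
  have h4 := Real.log_lt_sub_one_of_pos h3 hne
  rw [Real.log_div h2.ne' h1.ne'] at h4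
  have h5 : (1 + w / N) / (1 + u / N) - 1 ≤ (w - u) / N := by
    rw [div_sub_one h1.ne', div_le_iff₀ h1]
    have : 0 ≤ (w - u) / N * (u / N) := mul_nonneg (div_nonneg (by linarith) hN.le) (by positivity)
    have e : (w - u) / N = w / N - u / N := sub_div _ _ _
    nlinarith
  have h6 : N / 2 * (Real.log (1 + w / N) - Real.log (1 + u / N)) < N / 2 * ((w - u) / N) :=
    mul_lt_mul_of_pos_left (h4.trans_le h5) (by positivity)
  have h7 : N / 2 * ((w - u) / N) = (w - u) / 2 := by field_simp
  linarith

/-- The factor `√((n-1)/n)` is the ratio of the scale with divisor `n` in `s2EB` to the one with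
divisor `n - 1` in `sigma2Full`. Absorbing it into the variable compares a rescaled Student law with
the standard normal on the same interval `[-zQ, zQ]`. -/
theorem studentT_real_abs_le_lt {n : ℕ} (hn : 2 ≤ n) :
    (studentT ((n : ℝ) - 1)).real {t | |t| ≤ zQ * √(((n : ℝ) - 1) / n)} < 0.99 := by
  have hn2 : (2 : ℝ) ≤ n := by exact_mod_cast hn
  set ν : ℝ := (n : ℝ) - 1 with hν
  have hν0 : 0 < ν := by linarith
  have hn0 : (0 : ℝ) < n := by linarith
  set ρ : ℝ := √((n : ℝ) / ν) with hρ
  have hρ0 : 0 < ρ := by positivity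
  have hρi : √(ν / n) = ρ⁻¹ := by rw [hρ, ← Real.sqrt_inv, inv_div]
  have hρ2 : ρ ^ 2 = n / ν := Real.sq_sqrt (by positivity)
  have hz0 : 0 < zQ := lt_trans (by norm_num) zQ_bounds.1
  have := isProbabilityMeasure_studentT hν0
  have hmap := map_affineEquiv_withDensity 0 hρ0 (studentPDF ν)
  rw [← studentT_eq] at hmap
  set h : ℝ → ℝ := fun z => ρ⁻¹ * studentPDF ν ((z - 0) / ρ) with hh
  have hhc : Continuous h := by
    have := continuous_studentPDF hν0
    simp only [hh]
    fun_prop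
  have hh0 : ∀ t, 0 < h t := fun t => mul_pos (inv_pos.2 hρ0) (studentPDF_pos hν0 _)
  have hprob : IsProbabilityMeasure (volume.withDensity fun z => ENNReal.ofReal (h z)) := by
    rw [← hmap]; exact Measure.isProbabilityMeasure_map (MeasurableEquiv.measurable _).aemeasurable
  have hl1 : ∫⁻ z, ENNReal.ofReal (h z) = 1 := by
    have := hprob.measure_univ
    rwa [withDensity_apply _ MeasurableSet.univ, Measure.restrict_univ] at this
  have hhi : Integrable h := by
    refine ⟨hhc.aestronglyMeasurable, ?_⟩
    rw [hasFiniteIntegral_iff_ofReal (ae_of_all _ fun t => (hh0 t).le), hl1]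
    exact ENNReal.one_lt_top
  have hh1 : ∫ z, h z = 1 := by
    rw [integral_eq_lintegral_of_nonneg_ae (ae_of_all _ fun t => (hh0 t).le)
      hhc.aestronglyMeasurable, hl1, ENNReal.toReal_one]
  have hsetm : MeasurableSet {t : ℝ | |t| ≤ zQ} := measurableSet_le (by fun_prop) (by fun_prop)
  have hset : {t : ℝ | |t| ≤ zQ} = Set.Icc (-zQ) zQ := by ext t; simp [abs_le]
  have e1 : (studentT ν).real {t | |t| ≤ zQ * √(ν / n)} = ∫ t in (-zQ)..zQ, h t := by
    have hpre : {t : ℝ | |t| ≤ zQ * √(ν / n)} = affineEquiv 0 hρ0 ⁻¹' {t | |t| ≤ zQ} := by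
      ext t
      change |t| ≤ zQ * √(ν / n) ↔ |ρ * t + 0| ≤ zQ
      rw [add_zero, abs_mul, abs_of_pos hρ0, hρi, ← div_eq_mul_inv, le_div_iff₀' hρ0]
    rw [hpre, ← map_measureReal_apply (MeasurableEquiv.measurable _) hsetm, hmap, measureReal_def,
      withDensity_apply _ hsetm, hset, ← ofReal_integral_eq_lintegral_ofReal hhi.restrict
        (ae_of_all _ fun t => (hh0 t).le), ENNReal.toReal_ofReal
        (integral_nonneg fun t => (hh0 t).le), integral_Icc_eq_integral_Ioc,
      ← intervalIntegral.integral_of_le (by linarith)]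
  have e2 : ∫ t in (-zQ)..zQ, gaussianPDFReal 0 1 t = 0.99 := by
    rw [← gaussianReal_abs_le_zQ, measureReal_def, gaussianReal_apply_eq_integral _ one_ne_zero,
      hset, ENNReal.toReal_ofReal (integral_nonneg fun t => gaussianPDFReal_nonneg _ _ _),
      integral_Icc_eq_integral_Ioc, ← intervalIntegral.integral_of_le (by linarith)]
  -- The rescaling turns `1 + t²/(n-1)` into `1 + t²/n`, and the exponent `(ν + 1)/2` is `n/2`: the
  -- same `n` occurs twice, as `rpow_mul_exp_lt` requires.
  have hform : ∀ t, h t = h 0 * (1 + t ^ 2 / n) ^ (-((n : ℝ) / 2)) := fun t => by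
    have e : ∀ t : ℝ, ((t - 0) / ρ) ^ 2 / ν = t ^ 2 / n := fun t => by
      rw [sub_zero, div_pow, hρ2]; field_simp
    have e' : (ν + 1) / 2 = (n : ℝ) / 2 := by rw [hν]; ring
    simp only [hh, studentPDF, e, e']
    simp
    ring
  have hgform : ∀ t, gaussianPDFReal 0 1 t = (√(2 * Real.pi))⁻¹ * Real.exp (-t ^ 2 / 2) :=
    fun t => by simp [gaussianPDFReal]
  have hK : 0 < h 0 * (√(2 * Real.pi))⁻¹ := mul_pos (hh0 0) (by positivity)
  have key : ∀ s t : ℝ, |s| < |t| →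
      h s * gaussianPDFReal 0 1 t < h t * gaussianPDFReal 0 1 s := fun s t hst => by
    have := mul_lt_mul_of_pos_left
      (rpow_mul_exp_lt hn0 (sq_nonneg s) (sq_lt_sq.2 hst)) hK
    rw [hform s, hform t, hgform, hgform]
    linarith
  rw [e1, ← e2]
  refine integral_symm_lt ?_ hhc (fun t => gaussianPDFReal_pos _ _ _ one_ne_zero)
    (integrable_gaussianPDFReal _ _) hhi (integral_gaussianPDFReal_eq_one _ one_ne_zero) hh1 hz0
    (fun t ht => key t zQ (by rwa [abs_of_pos hz0])) (fun t ht => ?_) (by rw [e2]; norm_num)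
  · simp only [gaussianPDFReal]
    fun_prop
  · rcases eq_or_lt_of_le ht with h0 | hlt
    · have : t ^ 2 = zQ ^ 2 := by rw [← sq_abs t, ← h0]
      rw [hform t, hform zQ, hgform t, hgform zQ, this]
    · exact (key zQ t (by rwa [abs_of_pos hz0])).le

/-! ### The posterior under the prior density `1 / s²` -/

/-- The substitution `t = 1/l` turns this inverse-gamma integral into the Gamma integral. -/
theorem lintegral_Ioi_rpow_mul_exp_inv {s E : ℝ} (hs : 0 < s) (hE : 0 < E) :
    ∫⁻ l in Set.Ioi (0 : ℝ), ENNReal.ofReal (l ^ (-s - 1) * Real.exp (-(E / l))) =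
      ENNReal.ofReal ((1 / E) ^ s * Real.Gamma s) := by
  have h := integral_comp_rpow_Ioi (fun t : ℝ => t ^ (s - 1) * Real.exp (-(E * t)))
    (p := -1) (by norm_num)
  have e : ∀ l ∈ Set.Ioi (0 : ℝ), (|(-1 : ℝ)| * l ^ ((-1 : ℝ) - 1)) •
      ((l ^ (-1 : ℝ)) ^ (s - 1) * Real.exp (-(E * l ^ (-1 : ℝ)))) =
      l ^ (-s - 1) * Real.exp (-(E / l)) := fun l hl => by
    have hl : 0 < l := hl
    rw [abs_neg, abs_one, one_mul, smul_eq_mul, ← mul_assoc, ← Real.rpow_mul hl.le,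
      ← Real.rpow_add hl, Real.rpow_neg_one, div_eq_mul_inv]
    congr 2
    ring
  rw [setIntegral_congr_fun measurableSet_Ioi e, Real.integral_rpow_mul_exp_neg_mul_Ioi hs hE] at h
  have hpos : 0 < (1 / E) ^ s * Real.Gamma s :=
    mul_pos (by positivity) (Real.Gamma_pos_of_pos hs)
  rw [← h, ofReal_integral_eq_lintegral_ofReal
    (Integrable.of_integral_ne_zero (by rw [h]; exact hpos.ne'))]
  filter_upwards [self_mem_ae_restrict measurableSet_Ioi] with t ht
  have : 0 < t := ht
  positivity

/-- Marginalizing a normal mean: completing the square in `ξ` leaves `z` centred at `M`, with the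
uncertainty of `ξ` adding `b²/a` to `v`. -/
theorem lintegral_exp_mul_exp {a b v l : ℝ} (ha : 0 < a) (hv : 0 < v) (hl : 0 < l)
    (Q m M z : ℝ) :
    ∫⁻ ξ : ℝ, ENNReal.ofReal (Real.exp (-(Q + a * (ξ - m) ^ 2) / (2 * l)) *
      Real.exp (-(z - (M + b * (ξ - m))) ^ 2 / (2 * (l * v)))) =
    ENNReal.ofReal (Real.exp (-((Q + (z - M) ^ 2 / (b ^ 2 / a + v)) / 2 / l)) *
      √(Real.pi / ((a + b ^ 2 / v) / (2 * l)))) := by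
  have hτ : 0 < a * v + b ^ 2 := by positivity
  have e : ∀ ξ : ℝ, ENNReal.ofReal (Real.exp (-(Q + a * (ξ - m) ^ 2) / (2 * l)) *
      Real.exp (-(z - (M + b * (ξ - m))) ^ 2 / (2 * (l * v)))) =
      ENNReal.ofReal (Real.exp (-((Q + (z - M) ^ 2 / (b ^ 2 / a + v)) / 2 / l))) *
        ENNReal.ofReal (Real.exp (-((a + b ^ 2 / v) / (2 * l)) *
          (ξ - (m + b * (z - M) / (a * v + b ^ 2))) ^ 2)) := fun ξ => by
    rw [← ENNReal.ofReal_mul (Real.exp_pos _).le, ← Real.exp_add, ← Real.exp_add]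
    congr 2
    have h1 : b ^ 2 / a + v = (a * v + b ^ 2) / a := by field_simp; ring
    have h2 : a + b ^ 2 / v = (a * v + b ^ 2) / v := by field_simp
    rw [h1, h2]
    field_simp
    ring
  simp_rw [e]
  rw [lintegral_const_mul _ (by fun_prop), lintegral_exp_neg_mul_sq (by positivity),
    ← ENNReal.ofReal_mul (Real.exp_pos _).le]

theorem inv_sqrt_pow {l : ℝ} (hl : 0 < l) (n : ℕ) : (√l)⁻¹ ^ n = l ^ (-((n : ℝ) / 2)) := by
  rw [Real.sqrt_eq_rpow, ← Real.rpow_neg hl.le, ← Real.rpow_natCast, ← Real.rpow_mul hl.le]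
  congr 1
  ring

section FullBayes

variable {d n : ℕ} {Ω : Type*} [MeasurableSpace Ω] {f : Cube d → Ω → ℝ}
  {C : Cube d → Cube d → ℝ} {x : Fin n → Cube d} {y : Fin n → ℝ}

/-- The conditional mean is affine in the prior mean. Centring it at `mEB` matches the centre of the
likelihood, so that `lintegral_exp_mul_exp` applies. -/
theorem condMean_eq {G : Matrix (Fin n) (Fin n) ℝ} (hG : G.PosDef) (y c : Fin n → ℝ) (ξ : ℝ) :
    ξ + c ⬝ᵥ G⁻¹ *ᵥ (y - ξ • 1) = muEB G y c + (1 - c ⬝ᵥ G⁻¹ *ᵥ 1) * (ξ - mEB G y) := by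
  rw [← condMean_mEB hG]
  simp only [mulVec_sub, mulVec_smul, dotProduct_sub, dotProduct_smul, smul_eq_mul]
  ring

theorem tau_pos {G : Matrix (Fin n) (Fin n) ℝ} (hG : G.PosDef) (hy : ∃ i j, y i ≠ y j)
    {c : Fin n → ℝ} {c₀ : ℝ} (hv : 0 < condVar G c c₀) :
    0 < (1 - c ⬝ᵥ G⁻¹ *ᵥ 1) ^ 2 / (1 ⬝ᵥ G⁻¹ *ᵥ 1) + condVar G c c₀ := by
  have ha := quad_pos hG.inv (one_ne_zero_of_nonconst hy)
  positivity

theorem sigma2Full_pos {G : Matrix (Fin n) (Fin n) ℝ} (hG : G.PosDef) (hy : ∃ i j, y i ≠ y j)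
    {c : Fin n → ℝ} {c₀ : ℝ} (hv : 0 < condVar G c c₀) : 0 < sigma2Full G y c c₀ := by
  have hn : (2 : ℝ) ≤ n := by exact_mod_cast two_le_of_nonconst hy
  have h1 : 0 < 1 / ((n : ℝ) - 1) := one_div_pos.2 (by linarith)
  exact mul_pos (mul_pos h1 (projQuad_pos hG.inv hy)) (tau_pos hG hy hv)

/-- Integrating out `ξ` leaves `exp (-(Q + (z - M)²/τ)/(2 lam))` times `lam ^ (-n/2 - 1)`, and
integrating out `lam` gives the power `-n/2` of `Q + (z - M)²/τ`. This is a Student kernel with `n -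
1` degrees of freedom and squared scale `Qτ/(n - 1)`. The factor `k` may be left unspecified, as
normalization removes it. -/
theorem lintegral_joint_prior {P : ℝ → ℝ → Measure Ω}
    (hP : ∀ ξ lam, 0 < lam → IsGP (P ξ lam) f ξ fun t u => lam * C t u)
    (hf : Measurable (Function.uncurry f)) (hC : Integrable fun t => √(C t t))
    (hG : (gram C x).PosDef) (hy : ∃ i j, y i ≠ y j)
    (hv : 0 < condVar (gram C x) (cVec C x) (c0 C)) {κ : ℝ} (hκ : 0 < κ) :
    ∃ k : ℝ, 0 < k ∧ ∀ z, (∫⁻ lam in Set.Ioi (0 : ℝ), ∫⁻ ξ : ℝ,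
        ENNReal.ofReal (jointDensity (P ξ lam) f x y z) * ENNReal.ofReal (κ / lam)) =
      ENNReal.ofReal k * ENNReal.ofReal ((√(sigma2Full (gram C x) y (cVec C x) (c0 C)))⁻¹ *
        studentPDF ((n : ℝ) - 1) ((z - muEB (gram C x) y (cVec C x)) /
          √(sigma2Full (gram C x) y (cVec C x) (c0 C)))) := by
  have hn : (2 : ℝ) ≤ n := by exact_mod_cast two_le_of_nonconst hy
  have hQ := projQuad_pos hG.inv hy
  have h1 := one_ne_zero_of_nonconst hy
  have ha := quad_pos hG.inv h1
  have hσ2 := sigma2Full_pos hG hy hv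
  have hτ := tau_pos hG hy hv
  have hdet := Real.sqrt_pos.2 hG.det_pos
  have hσ2def : sigma2Full (gram C x) y (cVec C x) (c0 C) = 1 / ((n : ℝ) - 1) *
    projQuad (gram C x)⁻¹ y * ((1 - cVec C x ⬝ᵥ (gram C x)⁻¹ *ᵥ 1) ^ 2 /
      (1 ⬝ᵥ (gram C x)⁻¹ *ᵥ 1) + condVar (gram C x) (cVec C x) (c0 C)) := rfl
  set G := gram C x
  set c := cVec C x
  set v := condVar G c (c0 C)
  set Q := projQuad G⁻¹ y
  set a := (1 : Fin n → ℝ) ⬝ᵥ G⁻¹ *ᵥ 1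
  set b := 1 - c ⬝ᵥ G⁻¹ *ᵥ 1
  set M := muEB G y c
  set σ2 := sigma2Full G y c (c0 C)
  set τ := b ^ 2 / a + v
  have hσ := Real.sqrt_pos.2 hσ2
  have hα : 0 < a + b ^ 2 / v := by positivity
  set K : ℝ := (√(2 * Real.pi))⁻¹ ^ n * (√G.det)⁻¹ with hK
  have hK0 : 0 < K := by positivity
  set k2 : ℝ := K * κ * (√(v * (a + b ^ 2 / v)))⁻¹ with hk2
  have hk20 : 0 < k2 := by positivity
  have hinner : ∀ z, ∀ l ∈ Set.Ioi (0 : ℝ), (∫⁻ ξ : ℝ,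
      ENNReal.ofReal (jointDensity (P ξ l) f x y z) * ENNReal.ofReal (κ / l)) =
      ENNReal.ofReal k2 * ENNReal.ofReal (l ^ (-((n : ℝ) / 2) - 1) *
        Real.exp (-((Q + (z - M) ^ 2 / τ) / 2 / l))) := by
    intro z l hl
    have hl : 0 < l := hl
    have e : ∀ ξ : ℝ, ENNReal.ofReal (jointDensity (P ξ l) f x y z) * ENNReal.ofReal (κ / l) =
        ENNReal.ofReal (K * (√l)⁻¹ ^ n * (√(2 * Real.pi * (l * v)))⁻¹ * (κ / l)) *
          ENNReal.ofReal (Real.exp (-(Q + a * (ξ - mEB G y) ^ 2) / (2 * l)) *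
            Real.exp (-(z - (M + b * (ξ - mEB G y))) ^ 2 / (2 * (l * v)))) := fun ξ => by
      rw [(hP ξ l hl).jointDensity_eq hl hf hC hG hv, ← ENNReal.ofReal_mul (mul_nonneg
        (normalDensity_nonneg _ _ _) (gaussianPDFReal_nonneg _ _ _)),
        ← ENNReal.ofReal_mul (by positivity), normalDensity_smul hG hl,
        quad_sub_smul_one hG.inv h1, condMean_eq hG, gaussianPDFReal,
        Real.coe_toNNReal _ (by positivity)]
      congr 1
      simp only [mEB]
      ring
    simp_rw [e]
    rw [lintegral_const_mul _ (by fun_prop), lintegral_exp_mul_exp ha hv hl,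
      ← ENNReal.ofReal_mul (by positivity), ← ENNReal.ofReal_mul (by positivity)]
    congr 1
    -- The integral over `ξ` contributes `√l`, which cancels the `1/√l` of the conditional density
    -- of `z`; what remains is `l^(-n/2)` from the data and `1/l` from the prior.
    have hs1 : √(Real.pi / ((a + b ^ 2 / v) / (2 * l))) = √(2 * Real.pi * (l * v)) *
        (√(v * (a + b ^ 2 / v)))⁻¹ := by
      rw [← Real.sqrt_inv, ← Real.sqrt_mul (by positivity)]
      congr 1
      field_simp
    have hs2 : l ^ (-((n : ℝ) / 2) - 1) = (√l)⁻¹ ^ n / l := by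
      rw [inv_sqrt_pow hl, Real.rpow_sub_one hl.ne']
    have hs3 : √(2 * Real.pi * (l * v)) ≠ 0 := by positivity
    rw [hs1, hs2, hk2, show b ^ 2 / a + v = τ from rfl]
    generalize Real.exp (-((Q + (z - M) ^ 2 / τ) / 2 / l)) = X
    field_simp
  have hc := studentPDF_const_pos (ν := (n : ℝ) - 1) (by linarith)
  have hν1 : ((n : ℝ) - 1 + 1) / 2 = (n : ℝ) / 2 := by ring
  set cS := Real.Gamma (((n : ℝ) - 1 + 1) / 2) /
    (√(((n : ℝ) - 1) * Real.pi) * Real.Gamma (((n : ℝ) - 1) / 2)) with hcS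
  have hΓ := Real.Gamma_pos_of_pos (by linarith : 0 < (n : ℝ) / 2)
  -- The value of both integrals at `z = M`, divided by the Student constant `cS` and the factor
  -- `1/√σ2` that appear on the right-hand side.
  refine ⟨k2 * ((2 / Q) ^ ((n : ℝ) / 2) * Real.Gamma ((n : ℝ) / 2)) * √σ2 / cS, by positivity,
    fun z => ?_⟩
  have hE : 0 < (Q + (z - M) ^ 2 / τ) / 2 := by positivity
  rw [setLIntegral_congr_fun measurableSet_Ioi (hinner z), lintegral_const_mul _ (by fun_prop),
    lintegral_Ioi_rpow_mul_exp_inv (by linarith) hE, ← ENNReal.ofReal_mul (by positivity),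
    ← ENNReal.ofReal_mul (by positivity)]
  congr 1
  have hn1 : (n : ℝ) - 1 ≠ 0 := by linarith
  have hEE : 1 / ((Q + (z - M) ^ 2 / τ) / 2) =
      2 / Q * (1 + ((z - M) / √σ2) ^ 2 / ((n : ℝ) - 1))⁻¹ := by
    have : ((z - M) / √σ2) ^ 2 / ((n : ℝ) - 1) = (z - M) ^ 2 / τ / Q := by
      rw [div_pow, Real.sq_sqrt hσ2.le, hσ2def]
      field_simp
    have h3 : 0 < 1 + (z - M) ^ 2 / τ / Q := by positivity
    rw [this, one_div, inv_div, div_mul_eq_mul_div, ← div_eq_mul_inv, div_div]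
    congr 1
    field_simp
  have hp : 0 < 1 + ((z - M) / √σ2) ^ 2 / ((n : ℝ) - 1) := by
    have : 0 < (n : ℝ) - 1 := by linarith
    positivity
  rw [hEE, Real.mul_rpow (by positivity) (by positivity), Real.inv_rpow hp.le,
    ← Real.rpow_neg hp.le, studentPDF, ← hcS, hν1]
  field_simp

theorem posteriorOfPrior_eq {P : ℝ → ℝ → Measure Ω}
    (hP : ∀ ξ lam, 0 < lam → IsGP (P ξ lam) f ξ fun t u => lam * C t u)
    (hf : Measurable (Function.uncurry f)) (hC : Integrable fun t => √(C t t))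
    (hG : (gram C x).PosDef) (hy : ∃ i j, y i ≠ y j)
    (hv : 0 < condVar (gram C x) (cVec C x) (c0 C)) {κ : ℝ} (hκ : 0 < κ) :
    posteriorOfPrior (fun _ lam => κ / lam) P f x y = (studentT ((n : ℝ) - 1)).map
      (affineEquiv (muEB (gram C x) y (cVec C x)) (Real.sqrt_pos.2 (sigma2Full_pos hG hy hv))) := by
  have hn : (2 : ℝ) ≤ n := by exact_mod_cast two_le_of_nonconst hy
  have hν : 0 < (n : ℝ) - 1 := by linarith
  have := isProbabilityMeasure_studentT hν
  obtain ⟨k, hk, h⟩ := lintegral_joint_prior hP hf hC hG hy hv hκ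
  have hmap := map_affineEquiv_withDensity (muEB (gram C x) y (cVec C x))
    (Real.sqrt_pos.2 (sigma2Full_pos hG hy hv)) (studentPDF ((n : ℝ) - 1))
  rw [← studentT_eq] at hmap
  have hone := (Measure.isProbabilityMeasure_map (μ := studentT ((n : ℝ) - 1))
    (MeasurableEquiv.measurable (affineEquiv (muEB (gram C x) y (cVec C x))
      (Real.sqrt_pos.2 (sigma2Full_pos hG hy hv)))).aemeasurable).measure_univ
  rw [hmap, withDensity_apply _ MeasurableSet.univ, Measure.restrict_univ] at hone
  rw [hmap, posteriorOfPrior]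
  simp_rw [h]
  refine normalized_const_mul (by simpa using hk) (by simp) ?_ hone
  have := (continuous_studentPDF hν).measurable
  fun_prop

end FullBayes

/-! ### Credible intervals -/

theorem gaussian_credible (M : ℝ) {s2 v : ℝ} (hs : 0 < s2) (hv : 0 < v) (q : ℝ) :
    (gaussianReal M (s2 * v).toNNReal).real {z | |z - M| ≤ q * √s2 * √v} =
      (gaussianReal 0 1).real {t | |t| ≤ q} := by
  rw [mul_assoc, ← Real.sqrt_mul hs.le, real_abs_sub_le M (Real.sqrt_pos.2 (mul_pos hs hv)),
    gaussianReal_map_standardize M (mul_pos hs hv)]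

theorem gaussian_posterior_summary {n : ℕ} {G : Matrix (Fin n) (Fin n) ℝ} {c : Fin n → ℝ}
    {c₀ : ℝ} (hv : 0 < condVar G c c₀) {s2 : ℝ} (hs : 0 < s2) (M : ℝ) {post : Measure ℝ}
    (hpost : post = gaussianReal M (s2 * condVar G c c₀).toNNReal) :
    IsProbabilityMeasure post ∧ Integrable id post ∧ ∫ z, z ∂post = M ∧
      post.real {z | |z - M| ≤ errCI G c c₀ zQ s2} = 0.99 ∧
      0.99 < post.real {z | |z - M| ≤ errCI G c c₀ 2.58 s2} ∧
      post.real {z | |z - M| ≤ errCI G c c₀ 2.58 s2} < 0.9905 := by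
  subst hpost
  simp only [errCI, gaussian_credible M hs hv]
  exact ⟨inferInstance, (memLp_id_gaussianReal 1).integrable (by simp), integral_id_gaussianReal,
    gaussianReal_abs_le_zQ, gaussianReal_abs_le_rounded_gt, gaussianReal_abs_le_rounded_lt⟩

theorem student_posterior_summary {n : ℕ} (hn : 2 ≤ n) (M : ℝ) {σ : ℝ} (hσ : 0 < σ)
    {post : Measure ℝ} (hpost : post = (studentT ((n : ℝ) - 1)).map (affineEquiv M hσ)) :
    IsProbabilityMeasure post ∧
      post.map (fun z => (z - M) / σ) = studentT ((n : ℝ) - 1) ∧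
      (3 ≤ n → Integrable id post ∧ ∫ z, z ∂post = M) ∧
      post.real {z | |z - M| ≤ quantile (studentT ((n : ℝ) - 1)) 0.995 * σ} = 0.99 := by
  have hn2 : (2 : ℝ) ≤ n := by exact_mod_cast hn
  have := isProbabilityMeasure_studentT (ν := (n : ℝ) - 1) (by linarith)
  have := nullSingletonClass_studentT (ν := (n : ℝ) - 1)
  have hmap : post.map (fun z => (z - M) / σ) = studentT ((n : ℝ) - 1) := by
    rw [hpost, Measure.map_map (by fun_prop) (MeasurableEquiv.measurable _)]
    have : (fun z => (z - M) / σ) ∘ (affineEquiv M hσ) = id :=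
      funext fun t => (affineEquiv M hσ).left_inv t
    rw [this, Measure.map_id]
  refine ⟨?_, hmap, fun h3 => ?_, ?_⟩
  · rw [hpost]
    exact Measure.isProbabilityMeasure_map (MeasurableEquiv.measurable _).aemeasurable
  -- Here `n ≥ 3` makes the degrees of freedom `n - 1` exceed 1, so the first moment exists.
  · have hn3 : (3 : ℝ) ≤ n := by exact_mod_cast h3
    have hi : Integrable (fun t : ℝ => t) (studentT ((n : ℝ) - 1)) :=
      integrable_id_studentT (by linarith)
    rw [hpost]
    refine ⟨(integrable_map_measure (by fun_prop)
      (MeasurableEquiv.measurable _).aemeasurable).2 ?_, ?_⟩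
    · exact (hi.const_mul σ).add (integrable_const M)
    · rw [integral_map (MeasurableEquiv.measurable _).aemeasurable (by fun_prop)]
      change ∫ t, (σ * t + M) ∂_ = M
      rw [integral_add (hi.const_mul σ) (integrable_const M), integral_const_mul,
        integral_id_studentT]
      simp
  · rw [real_abs_sub_le M hσ, hmap]
    exact real_abs_le_quantile studentT_map_neg

/-- Two effects add up: the Student quantile exceeds `zQ √((n-1)/n)`, which already outweighs the
change of divisor, and `sigma2Full` contains the extra nonnegative variance due to the unknown mean.
-/
theorem errCI_lt_errFull {n : ℕ} {G : Matrix (Fin n) (Fin n) ℝ} {y c : Fin n → ℝ} {c₀ : ℝ}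
    (hG : G.PosDef) (hy : ∃ i j, y i ≠ y j) (hv : 0 < condVar G c c₀) :
    errCI G c c₀ zQ (s2EB G y) < errFull G y c c₀ := by
  have hn := two_le_of_nonconst hy
  have hn2 : (2 : ℝ) ≤ n := by exact_mod_cast hn
  have hν : 0 < (n : ℝ) - 1 := by linarith
  have hQ := projQuad_pos hG.inv hy
  have ha := quad_pos hG.inv (one_ne_zero_of_nonconst hy)
  have := isProbabilityMeasure_studentT hν
  have := nullSingletonClass_studentT (ν := (n : ℝ) - 1)
  have hq := lt_quantile_of_real_abs_le_lt studentT_map_neg (studentT_real_abs_le_lt hn)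
  have hq0 := quantile_pos (ν := studentT ((n : ℝ) - 1)) studentT_map_neg
    (by norm_num : (1 / 2 : ℝ) < 0.995) (by norm_num)
  have hw : 0 < 1 / ((n : ℝ) - 1) * projQuad G⁻¹ y * condVar G c c₀ := by positivity
  calc errCI G c c₀ zQ (s2EB G y)
      = zQ * √(((n : ℝ) - 1) / n) * √(1 / ((n : ℝ) - 1) * projQuad G⁻¹ y * condVar G c c₀) := by
        rw [errCI, s2EB, mul_assoc, ← Real.sqrt_mul (by positivity), mul_assoc zQ,
          ← Real.sqrt_mul (by positivity)]
        congr 2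
        field_simp
    _ < quantile (studentT ((n : ℝ) - 1)) 0.995 *
          √(1 / ((n : ℝ) - 1) * projQuad G⁻¹ y * condVar G c c₀) :=
        mul_lt_mul_of_pos_right hq (Real.sqrt_pos.2 hw)
    _ ≤ errFull G y c c₀ := by
        refine mul_le_mul_of_nonneg_left (Real.sqrt_le_sqrt ?_) hq0.le
        refine mul_le_mul_of_nonneg_left ?_ (by positivity)
        have : 0 ≤ (1 - c ⬝ᵥ G⁻¹ *ᵥ 1) ^ 2 / (1 ⬝ᵥ G⁻¹ *ᵥ 1) := by positivity
        linarith

end BayesCub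

end

/-! ### Estimates, cubatures and credible intervals -/

open BayesCub in
theorem mainTheorem4 {d n : ℕ} {Θ Ω : Type*} [MeasurableSpace Ω]
    -- the kernels `C_θ`
    (C : Θ → Cube d → Cube d → ℝ)
    (hC : ∀ θ, IsPosDefKernel (C θ))
    (hCint : ∀ θ, Integrable fun t => Real.sqrt (C θ t t))
    -- the integrand `f`, of law `GP(m, s² C_θ)` under `P m s² θ`
    (f : Cube d → Ω → ℝ) (hf : Measurable (Function.uncurry f))
    (P : ℝ → ℝ → Θ → Measure Ω)
    (hP : ∀ m s2 θ, 0 < s2 → IsGP (P m s2 θ) f m fun t u => s2 * C θ t u)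
    -- the nodes and the data
    (x : Fin n → Cube d) (hx : Function.Injective x)
    (y : Fin n → ℝ) (hy : ∃ i j, y i ≠ y j) :
    -- the factor 2.58 is the normal percentile, rounded to two decimals
    |zQ - 2.58| < 0.005 ∧
    -- empirical Bayes: maximizing the likelihood in `m`, then in `s²`, then in `θ`
    (∀ θ s2 m, 0 < s2 →
      (IsMaxOn (fun m' => logLik (P m' s2 θ) f x y) Set.univ m ↔ m = mEB (gram (C θ) x) y)) ∧
    (∀ θ, 0 < s2EB (gram (C θ) x) y ∧ ∀ s2, 0 < s2 →
      (IsMaxOn (fun s2' => logLik (P (mEB (gram (C θ) x) y) s2' θ) f x y) (Set.Ioi 0) s2 ↔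
        s2 = s2EB (gram (C θ) x) y)) ∧
    (∀ θ, IsMaxOn (fun θ' => logLik
          (P (mEB (gram (C θ') x) y) (s2EB (gram (C θ') x) y) θ') f x y) Set.univ θ ↔
        IsMinOn (fun θ' => objEB (gram (C θ') x) y) Set.univ θ) ∧
    -- generalized cross-validation: leave-one-out predictions and their variances, then
    -- minimizing GCV in `m`, then in `θ`, and the estimate of `s²`
    (∀ θ m s2 i, 0 < s2 →
      IsProbabilityMeasure (leaveOneOut (P m s2 θ) f x y i) ∧
      MemLp id 2 (leaveOneOut (P m s2 θ) f x y i) ∧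
      y i - ∫ w, w ∂(leaveOneOut (P m s2 θ) f x y i) =
        zeta (gram (C θ) x) y m i / (gram (C θ) x)⁻¹ i i ∧
      Var[id; leaveOneOut (P m s2 θ) f x y i] = s2 / (gram (C θ) x)⁻¹ i i) ∧
    (∀ θ m, IsMinOn (fun m' => gcv (gram (C θ) x) y m') Set.univ m ↔
      m = mGCV (gram (C θ) x) y) ∧
    (∀ θ, IsMinOn (fun θ' => gcv (gram (C θ') x) y (mGCV (gram (C θ') x) y)) Set.univ θ ↔
      IsMinOn (fun θ' => objGCV (gram (C θ') x) y) Set.univ θ) ∧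
    (∀ θ, 0 < s2GCV (gram (C θ) x) y ∧
      gcvScale (gram (C θ) x) y (mGCV (gram (C θ) x) y) = s2GCV (gram (C θ) x) y) ∧
    -- cubatures and credible intervals
    (∀ θ (G : Matrix (Fin n) (Fin n) ℝ) (c : Fin n → ℝ) (c₀ : ℝ),
      G = gram (C θ) x → c = cVec (C θ) x → c₀ = c0 (C θ) → 0 < condVar G c c₀ →
      -- empirical Bayes
      (∀ post, post = posterior (P (mEB G y) (s2EB G y) θ) f x y →
        IsProbabilityMeasure post ∧
        Integrable id post ∧ ∫ z, z ∂post = muEB G y c ∧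
        post.real {z | |z - muEB G y c| ≤ errCI G c c₀ zQ (s2EB G y)} = 0.99 ∧
        0.99 < post.real {z | |z - muEB G y c| ≤ errCI G c c₀ 2.58 (s2EB G y)} ∧
        post.real {z | |z - muEB G y c| ≤ errCI G c c₀ 2.58 (s2EB G y)} < 0.9905) ∧
      -- generalized cross-validation
      (∀ post, post = posterior (P (mGCV G y) (s2GCV G y) θ) f x y →
        IsProbabilityMeasure post ∧
        Integrable id post ∧ ∫ z, z ∂post = muGCV G y c ∧
        post.real {z | |z - muGCV G y c| ≤ errCI G c c₀ zQ (s2GCV G y)} = 0.99 ∧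
        0.99 < post.real {z | |z - muGCV G y c| ≤ errCI G c c₀ 2.58 (s2GCV G y)} ∧
        post.real {z | |z - muGCV G y c| ≤ errCI G c c₀ 2.58 (s2GCV G y)} < 0.9905) ∧
      -- full Bayes, with prior density proportional to `1/s²`
      (∀ κ : ℝ, 0 < κ → ∀ post,
        post = posteriorOfPrior (fun _ lam => κ / lam) (fun ξ lam => P ξ lam θ) f x y →
        IsProbabilityMeasure post ∧
        0 < sigma2Full G y c c₀ ∧
        post.map (fun z => (z - muEB G y c) / Real.sqrt (sigma2Full G y c c₀)) =
          studentT ((n : ℝ) - 1) ∧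
        (3 ≤ n → Integrable id post ∧ ∫ z, z ∂post = muEB G y c) ∧
        post.real {z | |z - muEB G y c| ≤ errFull G y c c₀} = 0.99) ∧
      errCI G c c₀ zQ (s2EB G y) < errFull G y c c₀) := by
  have hG : ∀ θ, (gram (C θ) x).PosDef := fun θ => (hC θ).posDef_gram hx
  have h1 : (1 : Fin n → ℝ) ≠ 0 := one_ne_zero_of_nonconst hy
  have hn : (0 : ℝ) < n := by have := two_le_of_nonconst hy; positivity
  have hlog : ∀ m s2 θ, 0 < s2 → logLik (P m s2 θ) f x y =
      Real.log (normalDensity (fun _ => m) (s2 • gram (C θ) x) y) := fun m s2 θ hs => by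
    rw [logLik, (hP m s2 θ hs).likelihood_eq hs hf (hCint θ) (hG θ)]
  refine ⟨?_, ?_, ?_, ?_, ?_, ?_, ?_, ?_, ?_⟩
  · rw [abs_lt]
    constructor <;> linarith [zQ_bounds.1, zQ_bounds.2]
  · intro θ s2 m hs
    refine isMaxOn_sub_sq_iff (b := (1 ⬝ᵥ (gram (C θ) x)⁻¹ *ᵥ 1) / (2 * s2))
      (k := -(n / 2 * Real.log (2 * Real.pi)) - Real.log (gram (C θ) x).det / 2 -
        n / 2 * Real.log s2 - projQuad (gram (C θ) x)⁻¹ y / (2 * s2))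
      (div_pos (quad_pos (hG θ).inv h1) (by positivity)) fun m' => ?_
    rw [hlog _ _ _ hs, log_normalDensity_smul (hG θ) h1 hs, add_div, ← sub_sub]
    congr 1
    ring
  · intro θ
    refine ⟨s2EB_pos (hG θ) hy, fun s2 hs => ?_⟩
    refine isMaxOn_log_sub_inv_iff
      (k := -(n / 2 * Real.log (2 * Real.pi)) - Real.log (gram (C θ) x).det / 2) hn
      (projQuad_pos (hG θ).inv hy) hs fun s hs' => ?_
    rw [hlog _ _ _ hs', log_normalDensity_smul (hG θ) h1 hs', sub_self, zero_pow two_ne_zero,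
      mul_zero, add_zero]
  · intro θ
    refine isMaxOn_iff_isMinOn_of_affine
      (k := -(n / 2 * Real.log (2 * Real.pi)) + n / 2 * Real.log n - n / 2)
      (by positivity : 0 < (n : ℝ) / 2) (fun θ' => ?_) θ
    rw [hlog _ _ _ (s2EB_pos (hG θ') hy), log_normalDensity_profile (hG θ') hy]
  · intro θ m s2 i hs
    have hd : 0 < (gram (C θ) x)⁻¹ i i := (hG θ).inv.diag_pos
    rw [(hP m s2 θ hs).leaveOneOut_eq hs hf (hCint θ) (hG θ)]
    refine ⟨inferInstance, memLp_id_gaussianReal 2, ?_, ?_⟩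
    · rw [integral_id_gaussianReal]
      ring
    · rw [variance_id_gaussianReal, Real.coe_toNNReal _ (by positivity)]
  · intro θ m
    have ht := trace_inv_pos (hG θ) hy
    exact isMinOn_add_sq_iff (mul_pos (by positivity) (quad_pos (posDef_sq (hG θ).inv) h1))
      fun m' => gcv_eq (hG θ) hy m'
  · intro θ
    simp only [isMinOn_iff, Set.mem_univ, true_implies]
    refine forall_congr' fun θ' => ?_
    have e := log_gcv_mGCV (hG θ) hy
    have e' := log_gcv_mGCV (hG θ') hy
    -- Both values are positive, and their logarithms differ from the objective by the same constant
    -- `2 log n`.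
    rw [← Real.log_le_log_iff e.1 e'.1, e.2, e'.2, add_le_add_iff_left]
  · exact fun θ => ⟨s2GCV_pos (hG θ) hy, gcvScale_mGCV (hG θ) hy⟩
  · rintro θ G c c₀ rfl rfl rfl hv
    refine ⟨fun post hpost => ?_, fun post hpost => ?_, fun κ hκ post hpost => ?_,
      errCI_lt_errFull (hG θ) hy hv⟩
    · have hs := s2EB_pos (hG θ) hy
      refine gaussian_posterior_summary hv hs _ ?_
      rw [hpost, (hP _ _ θ hs).posterior_eq hs hf (hCint θ) (hG θ) hv, condMean_mEB (hG θ)]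
    · have hs := s2GCV_pos (hG θ) hy
      refine gaussian_posterior_summary hv hs _ ?_
      rw [hpost, (hP _ _ θ hs).posterior_eq hs hf (hCint θ) (hG θ) hv, condMean_mGCV (hG θ)]
    · have hσ := sigma2Full_pos (hG θ) hy hv
      rw [posteriorOfPrior_eq (fun ξ lam hl => hP ξ lam θ hl) hf (hCint θ) (hG θ) hy hv hκ] at hpost
      have h := student_posterior_summary (two_le_of_nonconst hy) _ (Real.sqrt_pos.2 hσ) hpost
      exact ⟨h.1, hσ, h.2⟩
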